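/- **Setting.** Let $t=(t_{n\alpha})_{n\ge 0,\ \alpha\in\mathbb Z}$ be complex variables, all but finitely many of them zero, let $x\in\mathbb C$, and let $\theta=(\theta_1,\theta_2)$ be angle variables on the torus $T^2=(\mathbb R/2\pi\mathbb Z)^2$. A set of points $(t,x)$ is called open if its intersection with the subspace $\{t_{n\alpha}=0 \text{ for } (n,\alpha)\notin S\}$ is open for every finite set $S$ of indices. Let $\Omega$ be an open set of points $(t,x)$, and let $g_{n+1},h_n,u_n,v_n$ $(n\ge 1)$ be complex-valued functions of $(t,x,\theta)$, $(t,x)\in\Omega$, that are doubly $2\pi$-periodic in $\theta$ and, in restriction to any finite number of the times, smooth in $(t,x,\theta)$ and holomorphic in $(t,x)$. Consider the formal Laurent series in $k$ $$\mathcal L=k+\sum_{n\ge1}g_{n+1}k^{-n},\qquad \mathcal U=\theta_1+\sum_{n\ge1}u_n\mathcal L^{-n},$$ $$\mathcal M=\sum_{n,\alpha}n\,t_{n\alpha}\mathcal L^{n-1}e^{i\alpha\mathcal U}+x+\sum_{n\ge1}h_n\mathcal L^{-n-1},\qquad \mathcal V=\sum_{n,\alpha}i\alpha\,t_{n\alpha}\mathcal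 L^{n}e^{i\alpha\mathcal U}+\theta_2+\sum_{n\ge1}v_n\mathcal L^{-n},$$ put $\mathcal B_{n\alpha}=(\mathcal L^ne^{i\alpha\mathcal U})_{\ge0}$, the part with nonnegative powers of $k$, and $$\{A,B\}=\frac{\partial A}{\partial k}\frac{\partial B}{\partial x}-\frac{\partial A}{\partial x}\frac{\partial B}{\partial k}+\frac{\partial A}{\partial\theta_1}\frac{\partial B}{\partial\theta_2}-\frac{\partial A}{\partial\theta_2}\frac{\partial B}{\partial\theta_1}.$$ Suppose that $(\mathcal L,\mathcal M,\mathcal U,\mathcal V)$ is a solution over $\Omega$ of the toroidal hierarchy, that is, $$\frac{\partial\mathcal A}{\partial t_{n\alpha}}=\{\mathcal B_{n\alpha},\mathcal A\}\quad(\mathcal A=\mathcal L,\mathcal M,\mathcal U,\mathcal V,\ n\ge0,\ \alpha\in\mathbb Z),$$ $$\{\mathcal L,\mathcal M\}=\{\mathcal U,\mathcal V\}=1,\qquad \{\mathcal L,\mathcal U\}=\{\mathcal L,\mathcal V\}=\{\mathcal M,\mathcal U\}=\{\mathcal M,\mathcal V\}=0.$$ Let $\mathcal M(\lambda),\mathcal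 U(\lambda)$ be the Laurent series in $\lambda$ obtained from the above expressions of $\mathcal M,\mathcal U$ by replacing $\mathcal L$ by $\lambda$, and let $\operatorname{res}_\lambda\sum a_n\lambda^n=a_{-1}$. **Theorem.** The system $$\frac{\partial F}{\partial t_{n\alpha}}=\int_{T^2}\frac{d\theta_1d\theta_2}{(2\pi)^2}\operatorname{res}_\lambda\lambda^n\mathcal M(\lambda)e^{i\alpha\,\mathcal U(\lambda)},\qquad \frac{\partial F}{\partial x}=\int_{T^2}\frac{d\theta_1d\theta_2}{(2\pi)^2}\operatorname{res}_\lambda\lambda\mathcal M(\lambda),\qquad \frac{\partial F}{\partial\theta_j}=0\ (j=1,2)$$ is integrable in the sense of Frobenius on $\Omega$: the right hand sides, which do not depend on $\theta$, are differentiable in each of the variables $t_{n\alpha}$, $x$, and their cross derivatives agree. Hence the system defines a function $F=F(t,x)$ up to an integration constant: on every convex open $\Omega'\subseteq\Omega$ it has a solution $F_0(t,x)$, and every solution $F(t,x,\theta)$ on $\Omega'\times\mathbb R^2$ is of the form $F_0(t,x)+c$ with a constant $c\in\mathbb C$. This holds for every such solution of the hierarchy, in particular whenever, for every $\lambda$ in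 a neighborhood of $\infty$, the symplectic map $\theta\mapsto(\mathcal U(\lambda),\mathcal V(\lambda))$ is a diffeomorphism of the torus onto itself. -/

import Mathlib

open scoped ContDiff

noncomputable section

namespace Toroidal

/-- The time variables `t = (t_{nα})`, `n = 0, 1, …`, `α ∈ ℤ`, all but finitely many of them zero. -/
abbrev Times := (ℕ × ℤ) →₀ ℂ

/-- Functions of `(x, θ₁, θ₂)`. -/
abbrev Coef := ℂ × ℝ × ℝ → ℂ

/-- Formal Laurent series at infinity, with functions of `(x, θ)` as coefficients. The variable of
`LaurentSeries` stands for `k⁻¹` (or for `λ⁻¹`): the coefficient of `k ^ j` is `coeff (-j)`. -/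
abbrev Ser := LaurentSeries Coef

/-! ### Derivations, Poisson bracket, projection and residue -/

/-- `∂/∂x` on coefficient functions. -/
def coefDx : ZeroHom Coef Coef where
  toFun f := fun p => deriv (fun y : ℂ => f (y, p.2)) p.1
  map_zero' := by ext p; simp

/-- `∂/∂θ₁` on coefficient functions. -/
def coefD1 : ZeroHom Coef Coef where
  toFun f := fun p => deriv (fun s : ℝ => f (p.1, s, p.2.2)) p.2.1
  map_zero' := by ext p; simp

/-- `∂/∂θ₂` on coefficient functions. -/
def coefD2 : ZeroHom Coef Coef where
  toFun f := fun p => deriv (fun s : ℝ => f (p.1, p.2.1, s)) p.2.2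
  map_zero' := by ext p; simp

/-- `∂A/∂x`, coefficientwise. -/
def dx (A : Ser) : Ser := A.map coefDx

/-- `∂A/∂θ₁`, coefficientwise. -/
def dθ₁ (A : Ser) : Ser := A.map coefD1

/-- `∂A/∂θ₂`, coefficientwise. -/
def dθ₂ (A : Ser) : Ser := A.map coefD2

/-- `∂A/∂k`; with `z = k⁻¹` this is `- z² ∂A/∂z`. -/
def dk (A : Ser) : Ser := -(HahnSeries.single (2 : ℤ) (1 : Coef) * LaurentSeries.derivative Coef A)

/-- The four-dimensional Poisson bracket
`{A, B} = ∂ₖA ∂ₓB - ∂ₓA ∂ₖB + ∂_{θ₁}A ∂_{θ₂}B - ∂_{θ₂}A ∂_{θ₁}B`. -/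
def bracket (A B : Ser) : Ser :=
  dk A * dx B - dx A * dk B + dθ₁ A * dθ₂ B - dθ₂ A * dθ₁ B

/-- The projection `( )_{≥ 0}` onto nonnegative powers of `k`. -/
def nonnegPart (A : Ser) : Ser := HahnSeries.truncLT (1 : ℤ) A

/-- The formal residue `res ∑ aₙ λⁿ = a₋₁`. -/
def res (A : Ser) : Coef := A.coeff 1

/-- A function of `(x, θ)` as a constant Laurent series. -/
def const (f : Coef) : Ser := HahnSeries.C f

/-- The variable `k` (or `λ`) itself. -/
def var : Ser := HahnSeries.single (-1 : ℤ) (1 : Coef)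

/-- A power series in `k⁻¹` (or `λ⁻¹`) as a Laurent series. -/
def ofPS (P : PowerSeries Coef) : Ser := HahnSeries.ofPowerSeries ℤ Coef P

/-! ### The four functions `L, M, U, V` -/

/-- The dependent variables. With the usual numbering of the coefficients,
`g n = g_{n+2}`, `h n = h_{n+1}`, `u n = u_{n+1}` and `v n = v_{n+1}` for `n = 0, 1, …`. -/
structure Fields where
  g : ℕ → Times → Coef
  h : ℕ → Times → Coef
  u : ℕ → Times → Coef
  v : ℕ → Times → Coef

namespace Fields

variable (Φ : Fields) (t : Times)

/-- `L / k = 1 + ∑_{n ≥ 1} g_{n+1} k^{-n-1}`. -/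
def LdivK : PowerSeries Coef :=
  1 + PowerSeries.X ^ 2 * PowerSeries.mk (fun n => Φ.g n t)

/-- `L = k + ∑_{n ≥ 1} g_{n+1} k^{-n}`. -/
def L : Ser := var * ofPS (Φ.LdivK t)

/-- `L⁻¹`, as a power series in `k⁻¹`. -/
def Linv : PowerSeries Coef := PowerSeries.X * PowerSeries.invOfUnit (Φ.LdivK t) 1

theorem L_mul_Linv : Φ.L t * ofPS (Φ.Linv t) = 1 := by
  have h1 : Φ.LdivK t * PowerSeries.invOfUnit (Φ.LdivK t) 1 = 1 := by
    apply PowerSeries.mul_invOfUnit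
    simp [LdivK]
  have h2 : ofPS (Φ.LdivK t) * ofPS (PowerSeries.invOfUnit (Φ.LdivK t) 1) = 1 := by
    rw [ofPS, ofPS, ← map_mul, h1, map_one]
  have h3 : ofPS (Φ.Linv t) = HahnSeries.single (1 : ℤ) (1 : Coef) *
      ofPS (PowerSeries.invOfUnit (Φ.LdivK t) 1) := by
    rw [Linv, ofPS, ofPS, map_mul, HahnSeries.ofPowerSeries_X]
  have h4 : var * HahnSeries.single (1 : ℤ) (1 : Coef) = 1 := by
    rw [var, HahnSeries.single_mul_single]
    simp
  rw [L, h3, mul_mul_mul_comm, h4, h2, one_mul]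

/-! In the next definitions `Λ` is a Laurent series and `W` is its inverse, written as a power
series without constant term: either `Λ = λ`, `W = λ⁻¹`, or `Λ = L`, `W = L⁻¹`. -/

/-- `∑_{n ≥ 1} u_n Λ^{-n}`. -/
def uTail (W : PowerSeries Coef) : PowerSeries Coef :=
  (PowerSeries.X * PowerSeries.mk (fun n => Φ.u n t)).subst W

/-- `∑_{n ≥ 1} v_n Λ^{-n}`. -/
def vTail (W : PowerSeries Coef) : PowerSeries Coef :=
  (PowerSeries.X * PowerSeries.mk (fun n => Φ.v n t)).subst W

/-- `∑_{n ≥ 1} h_n Λ^{-n-1}`. -/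
def hTail (W : PowerSeries Coef) : PowerSeries Coef :=
  (PowerSeries.X ^ 2 * PowerSeries.mk (fun n => Φ.h n t)).subst W

/-- `θ₁ + ∑_{n ≥ 1} u_n Λ^{-n}`. -/
def Uof (W : PowerSeries Coef) : Ser := const (fun p => (p.2.1 : ℂ)) + ofPS (Φ.uTail t W)

/-- `exp (iα (θ₁ + ∑_{n ≥ 1} u_n Λ^{-n})) = e^{iαθ₁} exp (iα ∑_{n ≥ 1} u_n Λ^{-n})`, where the
second factor is the formal exponential series. -/
def expUof (α : ℤ) (W : PowerSeries Coef) : Ser :=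
  const (fun p => Complex.exp (Complex.I * α * p.2.1)) *
    ofPS ((PowerSeries.exp Coef).subst
      (PowerSeries.C (fun _ => Complex.I * α : Coef) * Φ.uTail t W))

/-- `∑_{n,α} n t_{nα} Λ^{n-1} e^{iαU} + x + ∑_{n ≥ 1} h_n Λ^{-n-1}`
(the truncated exponent is harmless, since the terms with `n = 0` vanish). -/
def Mof (Λ : Ser) (W : PowerSeries Coef) : Ser :=
  (t.sum fun i c => const (fun _ => (i.1 : ℂ) * c) * Λ ^ (i.1 - 1) * Φ.expUof t i.2 W)
    + const (fun p => p.1) + ofPS (Φ.hTail t W)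

/-- `∑_{n,α} iα t_{nα} Λ^n e^{iαU} + θ₂ + ∑_{n ≥ 1} v_n Λ^{-n}`. -/
def Vof (Λ : Ser) (W : PowerSeries Coef) : Ser :=
  (t.sum fun i c => const (fun _ => Complex.I * i.2 * c) * Λ ^ i.1 * Φ.expUof t i.2 W)
    + const (fun p => (p.2.2 : ℂ)) + ofPS (Φ.vTail t W)

/-- `M`, a Laurent series in `k`. -/
def M : Ser := Φ.Mof t (Φ.L t) (Φ.Linv t)

/-- `U`, a Laurent series in `k`. -/
def U : Ser := Φ.Uof t (Φ.Linv t)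

/-- `V`, a Laurent series in `k`. -/
def V : Ser := Φ.Vof t (Φ.L t) (Φ.Linv t)

/-- `e^{iαU}`, a Laurent series in `k`. -/
def expU (α : ℤ) : Ser := Φ.expUof t α (Φ.Linv t)

/-- `B_{nα} = (Lⁿ e^{iαU})_{≥ 0}`. -/
def B (i : ℕ × ℤ) : Ser := nonnegPart (Φ.L t ^ i.1 * Φ.expU t i.2)

/-- `M(λ)`, a Laurent series in the spectral parameter `λ`. -/
def Mspec : Ser := Φ.Mof t var PowerSeries.X

/-- `e^{iαU(λ)}`, a Laurent series in the spectral parameter `λ`. -/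
def expUspec (α : ℤ) : Ser := Φ.expUof t α PowerSeries.X

end Fields

/-! ### Solutions of the hierarchy -/

/-- The point of `(t, x)`-space with the given values of the times in `S` and zero other times. -/
def embed (S : Finset (ℕ × ℤ)) (q : (S → ℂ) × ℂ) : Times × ℂ :=
  (∑ i : S, Finsupp.single (i : ℕ × ℤ) (q.1 i), q.2)

/-- Open in the finite topology: for every finite set of times, the trace on the corresponding
finite-dimensional coordinate subspace of `(t, x)`-space is open. -/
def IsFinOpen (Ω : Set (Times × ℂ)) : Prop :=
  ∀ S : Finset (ℕ × ℤ), IsOpen (embed S ⁻¹' Ω)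

/-- Regularity of a function of `(t, x, θ)`, `(t, x) ∈ Ω`: in restriction to finitely many times
it is jointly smooth, and holomorphic in `(t, x)`. -/
def IsRegular (Ω : Set (Times × ℂ)) (f : Times → Coef) : Prop :=
  ∀ S : Finset (ℕ × ℤ),
    ContDiffOn ℝ ∞
      (fun q : ((S → ℂ) × ℂ) × ℝ × ℝ => f (embed S q.1).1 ((embed S q.1).2, q.2))
      {q | embed S q.1 ∈ Ω} ∧
    ∀ θ : ℝ × ℝ, DifferentiableOn ℂ
      (fun q : (S → ℂ) × ℂ => f (embed S q).1 ((embed S q).2, θ)) (embed S ⁻¹' Ω)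

/-- Double periodicity in `θ`: for `(t, x) ∈ Ω` the function is a function on the torus. -/
def IsDoublyPeriodic (Ω : Set (Times × ℂ)) (f : Times → Coef) : Prop :=
  ∀ t x, (t, x) ∈ Ω → ∀ a b : ℝ,
    f t (x, a + 2 * Real.pi, b) = f t (x, a, b) ∧ f t (x, a, b + 2 * Real.pi) = f t (x, a, b)

/-- Equality of two families of Laurent series, coefficient by coefficient, over `Ω`. -/
def EqOver (Ω : Set (Times × ℂ)) (A B : Times → Ser) : Prop :=
  ∀ t x, (t, x) ∈ Ω → ∀ (θ : ℝ × ℝ) (j : ℤ), (A t).coeff j (x, θ) = (B t).coeff j (x, θ)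

/-- The Lax equation `∂A/∂t_i = {B_i, A}` over `Ω`, coefficient by coefficient. -/
def LaxOver (Ω : Set (Times × ℂ)) (Φ : Fields) (i : ℕ × ℤ) (A : Times → Ser) : Prop :=
  ∀ t x, (t, x) ∈ Ω → ∀ (θ : ℝ × ℝ) (j : ℤ),
    HasLineDerivAt ℂ (fun t' => (A t').coeff j (x, θ))
      ((bracket (Φ.B t i) (A t)).coeff j (x, θ)) t (Finsupp.single i 1)

/-- `Φ` is a solution over `Ω` of the toroidal model of the dispersionless hierarchy. -/
structure IsSolution (Ω : Set (Times × ℂ)) (Φ : Fields) : Prop where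
  regular_g : ∀ n, IsRegular Ω (Φ.g n)
  regular_h : ∀ n, IsRegular Ω (Φ.h n)
  regular_u : ∀ n, IsRegular Ω (Φ.u n)
  regular_v : ∀ n, IsRegular Ω (Φ.v n)
  periodic_g : ∀ n, IsDoublyPeriodic Ω (Φ.g n)
  periodic_h : ∀ n, IsDoublyPeriodic Ω (Φ.h n)
  periodic_u : ∀ n, IsDoublyPeriodic Ω (Φ.u n)
  periodic_v : ∀ n, IsDoublyPeriodic Ω (Φ.v n)
  lax_L : ∀ i, LaxOver Ω Φ i Φ.L
  lax_M : ∀ i, LaxOver Ω Φ i Φ.M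
  lax_U : ∀ i, LaxOver Ω Φ i Φ.U
  lax_V : ∀ i, LaxOver Ω Φ i Φ.V
  bracket_LM : EqOver Ω (fun t => bracket (Φ.L t) (Φ.M t)) (fun _ => 1)
  bracket_UV : EqOver Ω (fun t => bracket (Φ.U t) (Φ.V t)) (fun _ => 1)
  bracket_LU : EqOver Ω (fun t => bracket (Φ.L t) (Φ.U t)) (fun _ => 0)
  bracket_LV : EqOver Ω (fun t => bracket (Φ.L t) (Φ.V t)) (fun _ => 0)
  bracket_MU : EqOver Ω (fun t => bracket (Φ.M t) (Φ.U t)) (fun _ => 0)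
  bracket_MV : EqOver Ω (fun t => bracket (Φ.M t) (Φ.V t)) (fun _ => 0)

/-! ### The system for the `F` function -/

/-- `∫ f(θ₁, θ₂) dθ₁dθ₂ / (2π)²` over the torus `0 ≤ θ_j ≤ 2π`. -/
def torusIntegral (f : ℝ → ℝ → ℂ) : ℂ :=
  (1 / (2 * Real.pi : ℂ) ^ 2) *
    ∫ a in (0 : ℝ)..(2 * Real.pi), ∫ b in (0 : ℝ)..(2 * Real.pi), f a b

/-- The independent variables `t_{nα}` (`some (n, α)`) and `x` (`none`), as directions in
`(t, x)`-space. -/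
def direction : Option (ℕ × ℤ) → Times × ℂ
  | some i => (Finsupp.single i 1, 0)
  | none => (0, 1)

/-- The right hand sides: `∫ res λⁿ M(λ) e^{iαU(λ)}` for `t_{nα}`, and `∫ res λ M(λ)` for `x`. -/
def Fields.rhs (Φ : Fields) : Option (ℕ × ℤ) → Times × ℂ → ℂ
  | some i => fun q => torusIntegral fun a b =>
      res (var ^ i.1 * Φ.Mspec q.1 * Φ.expUspec q.1 i.2) (q.2, a, b)
  | none => fun q => torusIntegral fun a b => res (var * Φ.Mspec q.1) (q.2, a, b)

/-- `F = F(t, x, θ)` solves over `Ω` the system `∂F/∂t_{nα} = ∫ res λⁿ M(λ) e^{iαU(λ)}`,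
`∂F/∂x = ∫ res λ M(λ)`, `∂F/∂θ_j = 0`. -/
def SolvesFSystem (Ω : Set (Times × ℂ)) (Φ : Fields) (F : Times × ℂ → ℝ × ℝ → ℂ) : Prop :=
  ∀ q ∈ Ω, ∀ θ : ℝ × ℝ,
    (∀ d, HasLineDerivAt ℂ (fun q' => F q' θ) (Φ.rhs d q) q (direction d)) ∧
    HasDerivAt (fun s : ℝ => F q (s, θ.2)) 0 θ.1 ∧
    HasDerivAt (fun s : ℝ => F q (θ.1, s)) 0 θ.2

end Toroidal

end

noncomputable section

namespace Toroidal

/-! Write `T_i = Lⁿ e^{iαU}` for `i = (n, α)`, and `I` for the torus average of the residue in `k`.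
Substituting `λ = L` in the residue (`IsComposition.residue_eq`) turns the right hand side for `t_i`
into `I(T_i M ∂ₖL)`.

The functional `I` kills derivatives in `k`, `θ₁` and `θ₂`, so forms restricted to constant `x` can
be integrated by parts. The flow of `t_j` is Hamiltonian with Hamiltonian `B_j`. Put `X = T_i M`, so
that `{L, X} = T_i`. Up to an exact form and a `k`-derivative, the variation of `X ∂ₖL` along `t_j`
is `∂ₖB_j {L, X}`. Hence the cross derivative is `I(∂ₖB_j T_i)` (`integral_flow_eq`).

Since `B_j` is the nonnegative part of `T_j`, antisymmetrizing in `i` and `j` removes the projection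
(`residue_truncLT_sub`), and the discrepancy of the two cross derivatives is `I(∂ₖT_j T_i)`. This
vanishes by `integral_deriv_mul_eq_zero`. The canonical relations give `dL ∧ dM + dU ∧ dV = dk ∧ dx
+ dθ₁ ∧ dθ₂`. At constant `x`, `∂ₖL dk∧dθ₁∧dθ₂` is therefore `dL∧dU∧dV`, and `∂ₖU dk∧dθ₁∧dθ₂` is
`dL∧dM∧dU`. Multiplied by powers of `L` and exponentials of `U`, both forms remain exact. The
variable `x` needs no separate argument: `B_{10} = k` and `{k, A} = ∂A/∂x`, so it behaves as the
time `t_{10}`.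

The calculus takes place in Laurent series over the algebra of regular periodic functions on a
finite-dimensional coordinate subspace. There the partial derivatives are genuine commuting
derivations, and `Represents` links this ring to the series of the statement. `U` and `V` are not
periodic, but their differentials are; only `U - θ₁`, `V - θ₂`, `dU`, `dV` and `e^{iαU}` enter.

Existence of `F₀` is the Poincaré lemma on a convex set: `F₀` is the integral along segments from a
base point (`hasFDerivAt_segmentIntegral_embed`). This integral does not mention the coordinate
subspace, so the finite-dimensional results fit together. Uniqueness comes from
`eq_of_hasLineDerivAt_single_eq_zero`. -/

/-- Derivations of a commutative ring, over the integers. -/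
structure Der (A : Type*) [CommRing A] extends A →+ A where
  leibniz' : ∀ a b, toFun (a * b) = a * toFun b + b * toFun a

/-! ### Elementary rules for derivations -/

namespace Der

variable {A : Type*} [CommRing A]

instance : FunLike (Der A) A A where
  coe D := D.toFun
  coe_injective D D' h := by
    cases D; cases D'
    congr
    exact DFunLike.coe_injective h

instance : AddMonoidHomClass (Der A) A A where
  map_add D := D.map_add'
  map_zero D := D.map_zero'

theorem leibniz (D : Der A) (a b : A) : D (a * b) = a * D b + b * D a := D.leibniz' a b

@[simp] theorem map_one (D : Der A) : D 1 = 0 := by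
  have h := D.leibniz 1 1
  simpa using h

@[simp] theorem map_natCast (D : Der A) (n : ℕ) : D (n : A) = 0 := by
  induction n with
  | zero => simp
  | succ n ih => rw [Nat.cast_succ, map_add, ih, map_one, add_zero]

@[simp] theorem map_intCast (D : Der A) (n : ℤ) : D (n : A) = 0 := by
  obtain ⟨n, rfl | rfl⟩ := n.eq_nat_or_neg <;> simp

theorem map_natCast_mul (D : Der A) (n : ℕ) (a : A) : D (n * a) = n * D a := by
  rw [leibniz, map_natCast, mul_zero, add_zero]

theorem map_intCast_mul (D : Der A) (n : ℤ) (a : A) : D (n * a) = n * D a := by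
  rw [leibniz, map_intCast, mul_zero, add_zero]

theorem map_pow_succ (D : Der A) (a : A) (n : ℕ) :
    D (a ^ (n + 1)) = (n + 1) * a ^ n * D a := by
  induction n with
  | zero => simp
  | succ n ih => rw [pow_succ, leibniz, ih]; push_cast; ring

/-- Derivations are only additive here, so vanishing on the rational constants `1 / n!` of the
exponential series must be deduced from vanishing on integers. -/
theorem map_eq_zero_of_natCast_mul_eq_one (D : Der A) {n : ℕ} {c : A} (h : (n : A) * c = 1) :
    D c = 0 := by
  have h1 := D.map_natCast_mul n c
  rw [h, map_one] at h1
  calc D c = (n * c) * D c := by rw [h, one_mul]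
    _ = c * (n * D c) := by ring
    _ = 0 := by rw [← h1, mul_zero]

end Der

/-! ### Products, derivations and residues of Laurent series -/

section LaurentAlgebra

variable {R : Type*} [CommRing R]

theorem exists_coeff_eq_zero_of_lt (A : LaurentSeries R) : ∃ p : ℤ, ∀ j < p, A.coeff j = 0 :=
  ⟨A.order, fun _ hj => HahnSeries.coeff_eq_zero_of_lt_order hj⟩

/-- The range of summation depends only on lower bounds for the orders, not on the supports. It
therefore survives coefficientwise maps, which may shrink supports, and multiplicativity and the
Leibniz rule can be checked term by term. -/
theorem coeff_mul_eq_sum_Icc {A B : LaurentSeries R} {p q : ℤ} (hA : ∀ j < p, A.coeff j = 0)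
    (hB : ∀ j < q, B.coeff j = 0) (j : ℤ) :
    (A * B).coeff j = ∑ i ∈ Finset.Icc p (j - q), A.coeff i * B.coeff (j - i) := by
  rw [HahnSeries.coeff_mul]
  have hinj : ∀ i ∈ Finset.Icc p (j - q), ∀ i' ∈ Finset.Icc p (j - q),
      ((i, j - i) : ℤ × ℤ) = (i', j - i') → i = i' := by
    intro i _ i' _ h
    exact (Prod.mk.inj h).1
  rw [← Finset.sum_image (g := fun i : ℤ => ((i, j - i) : ℤ × ℤ))
    (f := fun ij : ℤ × ℤ => A.coeff ij.1 * B.coeff ij.2) hinj]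
  apply Finset.sum_subset
  · rintro ⟨a, b⟩ h
    rw [Finset.mem_antidiagonal] at h
    obtain ⟨ha, hb, hab⟩ := h
    simp only [HahnSeries.mem_support] at ha hb
    have h1 : p ≤ a := by by_contra! h; exact ha (hA _ h)
    have h2 : q ≤ b := by by_contra! h; exact hb (hB _ h)
    simp only at hab
    rw [Finset.mem_image]
    refine ⟨a, Finset.mem_Icc.2 ⟨h1, by omega⟩, ?_⟩
    rw [Prod.mk.injEq]
    exact ⟨rfl, by omega⟩
  · rintro ⟨a, b⟩ h h'
    rw [Finset.mem_image] at h
    obtain ⟨i, -, hi⟩ := h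
    obtain ⟨rfl, rfl⟩ := Prod.mk.inj hi
    rw [Finset.mem_antidiagonal] at h'
    simp only [HahnSeries.mem_support] at h'
    by_contra hne
    exact h' ⟨fun h0 => hne (by simp [h0]), fun h0 => hne (by simp [h0]), by simp⟩

theorem coeff_mul_eq_zero_of_lt {A B : LaurentSeries R} {p q : ℤ} (hA : ∀ j < p, A.coeff j = 0)
    (hB : ∀ j < q, B.coeff j = 0) {j : ℤ} (hj : j < p + q) : (A * B).coeff j = 0 := by
  rw [coeff_mul_eq_sum_Icc hA hB, Finset.Icc_eq_empty (by omega), Finset.sum_empty]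

theorem coeff_mul_eq_zero_of_gt {A B : LaurentSeries R} {p q : ℤ} (hA : ∀ j, p < j → A.coeff j = 0)
    (hB : ∀ j, q < j → B.coeff j = 0) {j : ℤ} (hj : p + q < j) : (A * B).coeff j = 0 := by
  obtain ⟨a, ha⟩ := exists_coeff_eq_zero_of_lt A
  obtain ⟨b, hb⟩ := exists_coeff_eq_zero_of_lt B
  rw [coeff_mul_eq_sum_Icc ha hb]
  refine Finset.sum_eq_zero fun i _ => ?_
  rcases lt_or_ge p i with h | h
  · rw [hA i h, zero_mul]
  · rw [hB (j - i) (by omega), mul_zero]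

/-- The coefficientwise image of a Laurent series under a ring homomorphism. -/
def mapLaurent {R' : Type*} [CommRing R'] (φ : R →+* R') : LaurentSeries R →+* LaurentSeries R' where
  toFun A := A.map φ
  map_zero' := by ext; simp
  map_one' := by
    ext j
    simp only [HahnSeries.map_coeff, HahnSeries.coeff_one]
    split_ifs <;> simp
  map_add' A B := by ext; simp
  map_mul' A B := by
    obtain ⟨p, hp⟩ := exists_coeff_eq_zero_of_lt A
    obtain ⟨q, hq⟩ := exists_coeff_eq_zero_of_lt B
    ext j
    rw [HahnSeries.map_coeff, coeff_mul_eq_sum_Icc hp hq,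
      coeff_mul_eq_sum_Icc (p := p) (q := q) (fun j hj => by simp [hp j hj])
        (fun j hj => by simp [hq j hj])]
    simp

@[simp] theorem mapLaurent_coeff {R' : Type*} [CommRing R'] (φ : R →+* R') (A : LaurentSeries R)
    (j : ℤ) : (mapLaurent φ A).coeff j = φ (A.coeff j) := rfl

theorem mapLaurent_single {R' : Type*} [CommRing R'] (φ : R →+* R') (j : ℤ) (r : R) :
    mapLaurent φ (HahnSeries.single j r) = HahnSeries.single j (φ r) := by
  ext i
  simp only [mapLaurent_coeff, HahnSeries.coeff_single]
  split_ifs <;> simp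

theorem mapLaurent_C {R' : Type*} [CommRing R'] (φ : R →+* R') (r : R) :
    mapLaurent φ (HahnSeries.C r) = HahnSeries.C (φ r) :=
  mapLaurent_single φ 0 r

theorem ofPowerSeries_coeff (P : PowerSeries R) (j : ℤ) :
    (HahnSeries.ofPowerSeries ℤ R P).coeff j = if j < 0 then 0 else PowerSeries.coeff j.natAbs P :=
  PowerSeries.coeff_coe P j

theorem mapLaurent_ofPowerSeries {R' : Type*} [CommRing R'] (φ : R →+* R') (P : PowerSeries R) :
    mapLaurent φ (HahnSeries.ofPowerSeries ℤ R P) =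
      HahnSeries.ofPowerSeries ℤ R' (PowerSeries.map φ P) := by
  ext j
  rw [mapLaurent_coeff, ofPowerSeries_coeff, ofPowerSeries_coeff]
  split_ifs <;> simp

/-- A graded family of derivation-like maps on the coefficients gives a derivation of the ring of
Laurent series. -/
def familyDerivation (φ : ℤ → R →+ R)
    (hφ : ∀ i l a b, φ (i + l) (a * b) = a * φ l b + b * φ i a) : Der (LaurentSeries R) where
  toFun A := ⟨fun j => φ j (A.coeff j), A.isPWO_support.mono fun j hj h0 =>
    hj (by simp only [h0, map_zero])⟩
  map_zero' := by ext; simp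
  map_add' A B := by ext; simp
  leibniz' A B := by
    obtain ⟨p, hp⟩ := exists_coeff_eq_zero_of_lt A
    obtain ⟨q, hq⟩ := exists_coeff_eq_zero_of_lt B
    ext j
    rw [HahnSeries.coeff_add, mul_comm B, coeff_mul_eq_sum_Icc (p := p) (q := q) hp
      (fun j hj => by simp [hq j hj]), coeff_mul_eq_sum_Icc (p := p) (q := q)
      (fun j hj => by simp [hp j hj]) hq]
    simp only
    rw [coeff_mul_eq_sum_Icc hp hq, map_sum, ← Finset.sum_add_distrib]
    refine Finset.sum_congr rfl fun i _ => ?_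
    have h := hφ i (j - i) (A.coeff i) (B.coeff (j - i))
    rw [add_sub_cancel] at h
    rw [h, mul_comm (B.coeff _)]

/-- The coefficientwise extension of a derivation to Laurent series. -/
def coeffDerivation (δ : Der R) : Der (LaurentSeries R) :=
  familyDerivation (fun _ => δ.toAddMonoidHom) fun _ _ a b => δ.leibniz a b

@[simp] theorem coeffDerivation_coeff (δ : Der R) (A : LaurentSeries R) (j : ℤ) :
    (coeffDerivation δ A).coeff j = δ (A.coeff j) := rfl

/-- The derivation `∂/∂k` of the ring of Laurent series in `k⁻¹`. -/
def kDerivation : Der (LaurentSeries R) where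
  -- With `z = k⁻¹`, `∂/∂k = -z · (z ∂/∂z)`, and the Euler operator `z ∂/∂z` multiplies the
  -- coefficient of degree `j` by `j`.
  toFun A := -HahnSeries.single (1 : ℤ) (1 : R) *
    familyDerivation (fun j => (j • AddMonoidHom.id R)) (fun i l a b => by
      simp [add_mul]; ring) A
  map_zero' := by simp
  map_add' A B := by rw [map_add, mul_add]
  leibniz' A B := by rw [Der.leibniz]; ring

theorem kDerivation_coeff (A : LaurentSeries R) (j : ℤ) :
    (kDerivation A).coeff j = (1 - j) * A.coeff (j - 1) := by
  have h : kDerivation A = (-HahnSeries.single (1 : ℤ) (1 : R)) *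
    familyDerivation (fun j => (j • AddMonoidHom.id R)) (fun i l a b => by
      simp [add_mul]; ring) A := rfl
  rw [h, neg_mul, HahnSeries.coeff_neg, HahnSeries.coeff_single_mul, one_mul]
  change - ((j - 1) • A.coeff (j - 1)) = _
  simp [sub_mul]

/-- The factor `1 - j` vanishes at `j = 1`, the index of `k⁻¹`. This is the source of every
integration by parts in `k`. -/
theorem kDerivation_coeff_one (A : LaurentSeries R) : (kDerivation A).coeff 1 = 0 := by
  simp [kDerivation_coeff]

theorem kDerivation_coeffDerivation (δ : Der R) (A : LaurentSeries R) :
    kDerivation (coeffDerivation δ A) = coeffDerivation δ (kDerivation A) := by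
  ext j
  have : (1 - (j : R)) = ((1 - j : ℤ) : R) := by push_cast; ring
  rw [kDerivation_coeff, coeffDerivation_coeff, coeffDerivation_coeff, kDerivation_coeff, this,
    Der.map_intCast_mul]

theorem coeffDerivation_comm {δ δ' : Der R} (h : ∀ r, δ (δ' r) = δ' (δ r))
    (A : LaurentSeries R) :
    coeffDerivation δ (coeffDerivation δ' A) = coeffDerivation δ' (coeffDerivation δ A) := by
  ext j
  simp [h]

theorem coeffDerivation_single (δ : Der R) (j : ℤ) (r : R) :
    coeffDerivation δ (HahnSeries.single j r) = HahnSeries.single j (δ r) := by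
  ext i
  simp only [coeffDerivation_coeff, HahnSeries.coeff_single]
  split_ifs <;> simp

theorem coeffDerivation_C (δ : Der R) (r : R) :
    coeffDerivation δ (HahnSeries.C r) = HahnSeries.C (δ r) :=
  coeffDerivation_single δ 0 r

theorem kDerivation_C (r : R) : kDerivation (HahnSeries.C r) = 0 := by
  ext j
  simp only [kDerivation_coeff, HahnSeries.C_apply, HahnSeries.coeff_single, HahnSeries.coeff_zero]
  split_ifs with h
  · have : j = 1 := by omega
    simp [this]
  · simp

theorem kDerivation_var : kDerivation (HahnSeries.single (-1 : ℤ) (1 : R)) = 1 := by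
  ext j
  simp only [kDerivation_coeff, HahnSeries.coeff_single, HahnSeries.coeff_one]
  by_cases h : j = 0
  · simp [h]
  · rw [if_neg h, if_neg (by omega), mul_zero]

/-- The antisymmetry of the residue pairing, in terms of nonnegative parts. -/
theorem residue_truncLT_sub (S T : LaurentSeries R) :
    (kDerivation (HahnSeries.truncLT (1 : ℤ) S) * T).coeff 1 -
      (kDerivation (HahnSeries.truncLT (1 : ℤ) T) * S).coeff 1 = (kDerivation S * T).coeff 1 := by
  set Sp := HahnSeries.truncLT (1 : ℤ) S with hSp
  set Tp := HahnSeries.truncLT (1 : ℤ) T with hTp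
  obtain ⟨Sm, hSm⟩ : ∃ Sm, S = Sp + Sm := ⟨S - Sp, by ring⟩
  obtain ⟨Tm, hTm⟩ : ∃ Tm, T = Tp + Tm := ⟨T - Tp, by ring⟩
  have pos : ∀ A : LaurentSeries R, ∀ j : ℤ, 0 < j →
      (HahnSeries.truncLT (1 : ℤ) A).coeff j = 0 := fun A j hj =>
    HahnSeries.coeff_truncLT_of_le (by omega) A
  have neg : ∀ A Ap Am : LaurentSeries R, Ap = HahnSeries.truncLT (1 : ℤ) A → A = Ap + Am →
      ∀ j < (1 : ℤ), Am.coeff j = 0 := by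
    intro A Ap Am h1 h2 j hj
    have := congrArg (fun B => HahnSeries.coeff B j) h2
    simp only [HahnSeries.coeff_add, h1, HahnSeries.coeff_truncLT_of_lt hj] at this
    simpa using this
  have dpos : ∀ A : LaurentSeries R, (∀ j : ℤ, 0 < j → A.coeff j = 0) →
      ∀ j : ℤ, 0 < j → (kDerivation A).coeff j = 0 := by
    intro A hA j hj
    rw [kDerivation_coeff]
    rcases eq_or_ne j 1 with rfl | h
    · simp
    · rw [hA _ (by omega), mul_zero]
  -- Two polynomials in `k` contribute no residue. In `mm` below, two negative parts contribute none
  -- either, their product being `O(k⁻³)`. Only the mixed terms survive, and `ibp` exchanges them.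
  have pp : ∀ A B : LaurentSeries R, (∀ j : ℤ, 0 < j → A.coeff j = 0) →
      (∀ j : ℤ, 0 < j → B.coeff j = 0) → (kDerivation A * B).coeff 1 = 0 := fun A B hA hB =>
    coeff_mul_eq_zero_of_gt (dpos A hA) hB (by omega)
  have mm : (kDerivation Sm * Tm).coeff 1 = 0 := by
    refine coeff_mul_eq_zero_of_lt (p := 2) (q := 1) (fun j hj => ?_) (neg T Tp Tm hTp hTm)
      (by omega)
    rw [kDerivation_coeff, neg S Sp Sm hSp hSm _ (by omega), mul_zero]
  have ibp : (kDerivation Sm * Tp).coeff 1 + (kDerivation Tp * Sm).coeff 1 = 0 := by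
    rw [← HahnSeries.coeff_add, ← kDerivation_coeff_one (Sm * Tp), Der.leibniz]
    congr 1
    ring
  have e1 := pp Sp Tp (pos S) (pos T)
  have e2 := pp Tp Sp (pos T) (pos S)
  have e3 : kDerivation S * T = kDerivation Sp * T + kDerivation Sm * Tp + kDerivation Sm * Tm := by
    conv_lhs => rw [hSm, hTm, map_add]
    conv_rhs => rw [hTm]
    ring
  have e4 : kDerivation Tp * S = kDerivation Tp * Sp + kDerivation Tp * Sm := by
    conv_lhs => rw [hSm]
    ring
  rw [e3, e4]
  simp only [HahnSeries.coeff_add]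
  rw [mm, e2]
  linear_combination -ibp

end LaurentAlgebra

/-! ### Substitution of power series, and composition with `L` -/

section Substitution

variable {R : Type*} [CommRing R]

/-- Splitting off the constant term `N` times leaves a remainder divisible by `W ^ N`. Any single
coefficient of a substituted series is thus governed by a finite sum. -/
theorem exists_subst_eq_sum_add {W : PowerSeries R} (hW : PowerSeries.constantCoeff W = 0) (N : ℕ)
    (P : PowerSeries R) : ∃ Q : PowerSeries R, P.subst W =
      ∑ n ∈ Finset.range N, PowerSeries.C (PowerSeries.coeff n P) * W ^ n + W ^ N * Q := by
  have hs : PowerSeries.HasSubst W := PowerSeries.HasSubst.of_constantCoeff_zero' hW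
  induction N generalizing P with
  | zero => exact ⟨P.subst W, by simp⟩
  | succ N ih =>
    obtain ⟨Q, hQ⟩ := ih (PowerSeries.mk fun n => PowerSeries.coeff (n + 1) P)
    refine ⟨Q, ?_⟩
    have hP := P.eq_X_mul_shift_add_const
    conv_lhs => rw [hP, PowerSeries.subst_add hs, PowerSeries.subst_mul hs, PowerSeries.subst_X hs,
      PowerSeries.subst_C, hQ]
    simp only [PowerSeries.coeff_mk]
    rw [Finset.sum_range_succ', mul_add, Finset.mul_sum]
    have : ∀ n, W * (PowerSeries.C (PowerSeries.coeff (n + 1) P) * W ^ n) =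
        PowerSeries.C (PowerSeries.coeff (n + 1) P) * W ^ (n + 1) := fun n => by ring
    simp only [this]
    change _ + PowerSeries.C _ = _
    rw [PowerSeries.coeff_zero_eq_constantCoeff_apply]
    ring

theorem ofPowerSeries_coeff_of_neg (P : PowerSeries R) {j : ℤ} (hj : j < 0) :
    (HahnSeries.ofPowerSeries ℤ R P).coeff j = 0 := by
  rw [ofPowerSeries_coeff, if_pos hj]

theorem ofPowerSeries_coeff_natCast (P : PowerSeries R) (n : ℕ) :
    (HahnSeries.ofPowerSeries ℤ R P).coeff n = PowerSeries.coeff n P := by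
  rw [ofPowerSeries_coeff, if_neg (by omega), Int.natAbs_natCast]

theorem ofPowerSeries_pow_mul_coeff_of_lt {y : PowerSeries R}
    (hy : PowerSeries.constantCoeff y = 0) (N : ℕ) (Q : PowerSeries R) {j : ℤ} (hj : j < N) :
    (HahnSeries.ofPowerSeries ℤ R (y ^ N * Q)).coeff j = 0 := by
  rw [ofPowerSeries_coeff]
  split_ifs with h
  · rfl
  · obtain ⟨z, rfl⟩ := PowerSeries.X_dvd_iff.2 hy
    rw [mul_pow, mul_assoc, PowerSeries.coeff_X_pow_mul', if_neg (by omega)]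

/-- Derivations of the ring of Laurent series that do not lower the order in `k⁻¹`. -/
def IsLocalDer (D : Der (LaurentSeries R)) : Prop :=
  ∀ (N : ℤ) (A : LaurentSeries R), (∀ j < N, A.coeff j = 0) → ∀ j < N, (D A).coeff j = 0

theorem isLocalDer_coeffDerivation (δ : Der R) : IsLocalDer (coeffDerivation δ) :=
  fun N A hA j hj => by simp [hA j hj]

theorem isLocalDer_kDerivation : IsLocalDer (kDerivation (R := R)) :=
  fun N A hA j hj => by rw [kDerivation_coeff, hA _ (by omega), mul_zero]

theorem coeff_C_mul (r : R) (A : LaurentSeries R) (j : ℤ) :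
    (HahnSeries.C r * A).coeff j = r * A.coeff j := by
  rw [HahnSeries.C_apply, HahnSeries.coeff_single_mul, sub_zero]

/-- `L = kℓ`, for a power series `ℓ` in `k⁻¹`. -/
def laxOf (ℓ : PowerSeries R) : LaurentSeries R :=
  HahnSeries.single (-1 : ℤ) (1 : R) * HahnSeries.ofPowerSeries ℤ R ℓ

/-- `(kℓ)⁻¹`, for a power series `ℓ` in `k⁻¹` with constant term `1`. -/
def laxInvOf (ℓ : PowerSeries R) : PowerSeries R :=
  PowerSeries.X * PowerSeries.invOfUnit ℓ 1

theorem constantCoeff_laxInvOf (ℓ : PowerSeries R) :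
    PowerSeries.constantCoeff (laxInvOf ℓ) = 0 := by
  simp [laxInvOf]

theorem laxOf_mul_laxInvOf {ℓ : PowerSeries R} (hℓ : PowerSeries.constantCoeff ℓ = 1) :
    laxOf ℓ * HahnSeries.ofPowerSeries ℤ R (laxInvOf ℓ) = 1 := by
  have h1 : ℓ * PowerSeries.invOfUnit ℓ 1 = 1 := PowerSeries.mul_invOfUnit _ _ (by simp [hℓ])
  rw [laxOf, laxInvOf, map_mul, HahnSeries.ofPowerSeries_X, mul_mul_mul_comm,
    ← map_mul (HahnSeries.ofPowerSeries ℤ R), h1, HahnSeries.single_mul_single]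
  simp

theorem coeff_kDerivation_laxOf_of_neg (ℓ : PowerSeries R) {j : ℤ} (hj : j < 0) :
    (kDerivation (laxOf ℓ)).coeff j = 0 := by
  rw [kDerivation_coeff, laxOf, HahnSeries.coeff_single_mul,
    ofPowerSeries_coeff_of_neg _ (by omega), mul_zero, mul_zero]

theorem coeff_zero_kDerivation_laxOf {ℓ : PowerSeries R}
    (hℓ : PowerSeries.constantCoeff ℓ = 1) : (kDerivation (laxOf ℓ)).coeff 0 = 1 := by
  rw [kDerivation_coeff, laxOf, HahnSeries.coeff_single_mul, ofPowerSeries_coeff]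
  simp [hℓ]

/-- The logarithmic derivative of `L = kℓ` starts with `k⁻¹ · 1`, because `ℓ` has constant term `1`.
-/
theorem residue_laxInvOf_mul {ℓ : PowerSeries R} (hℓ : PowerSeries.constantCoeff ℓ = 1) :
    (HahnSeries.ofPowerSeries ℤ R (laxInvOf ℓ) * kDerivation (laxOf ℓ)).coeff 1 = 1 := by
  rw [coeff_mul_eq_sum_Icc (p := 1) (q := 0) (fun j hj => ?_)
    (fun j hj => coeff_kDerivation_laxOf_of_neg ℓ hj)]
  · have h : (HahnSeries.ofPowerSeries ℤ R (laxInvOf ℓ)).coeff 1 = 1 := by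
      rw [ofPowerSeries_coeff]
      simp [laxInvOf, PowerSeries.coeff_succ_X_mul]
    simp [h, coeff_zero_kDerivation_laxOf hℓ]
  · have h := ofPowerSeries_pow_mul_coeff_of_lt (constantCoeff_laxInvOf ℓ) 1 1 (j := j)
      (by exact_mod_cast hj)
    rwa [pow_one, mul_one] at h

/-- `f' = f(L)` for the Laurent series `f = f(λ)`, where `L = kℓ`. -/
def IsComposition (ℓ : PowerSeries R) (f f' : LaurentSeries R) : Prop :=
  ∃ (N : ℕ) (P : PowerSeries R),
    f = HahnSeries.single (-1 : ℤ) (1 : R) ^ N * HahnSeries.ofPowerSeries ℤ R P ∧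
    f' = laxOf ℓ ^ N * HahnSeries.ofPowerSeries ℤ R (P.subst (laxInvOf ℓ))

theorem hasSubst_laxInvOf (ℓ : PowerSeries R) : PowerSeries.HasSubst (laxInvOf ℓ) :=
  PowerSeries.HasSubst.of_constantCoeff_zero' (constantCoeff_laxInvOf ℓ)

namespace IsComposition

variable {ℓ : PowerSeries R} {f f' g g' : LaurentSeries R}

theorem powerSeries (P : PowerSeries R) : IsComposition ℓ (HahnSeries.ofPowerSeries ℤ R P)
    (HahnSeries.ofPowerSeries ℤ R (P.subst (laxInvOf ℓ))) :=
  ⟨0, P, by simp, by simp⟩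

theorem var_pow (N : ℕ) :
    IsComposition ℓ (HahnSeries.single (-1 : ℤ) (1 : R) ^ N) (laxOf ℓ ^ N) := by
  refine ⟨N, 1, by simp, ?_⟩
  have : (1 : PowerSeries R).subst (laxInvOf ℓ) = (1 : PowerSeries R) := by
    rw [← PowerSeries.coe_substAlgHom (hasSubst_laxInvOf ℓ), map_one]
  rw [this, map_one, mul_one]

theorem C (r : R) : IsComposition ℓ (HahnSeries.C r) (HahnSeries.C r) := by
  have h := powerSeries (ℓ := ℓ) (PowerSeries.C r)
  rw [PowerSeries.subst_C] at h
  change IsComposition ℓ _ (HahnSeries.ofPowerSeries ℤ R (PowerSeries.C r)) at h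
  rwa [HahnSeries.ofPowerSeries_C] at h

theorem mul (hf : IsComposition ℓ f f') (hg : IsComposition ℓ g g') :
    IsComposition ℓ (f * g) (f' * g') := by
  obtain ⟨N, P, rfl, rfl⟩ := hf
  obtain ⟨M, Q, rfl, rfl⟩ := hg
  refine ⟨N + M, P * Q, ?_, ?_⟩
  · rw [map_mul]; ring
  · rw [PowerSeries.subst_mul (hasSubst_laxInvOf ℓ), map_mul]; ring

/-- The presentation `λ^N P(λ⁻¹)` is not unique: multiplying `P` by `λ^{-M}` allows a larger
exponent. This brings two summands to a common power of `λ` in `add`. -/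
theorem exists_add (hℓ : PowerSeries.constantCoeff ℓ = 1) (N M : ℕ) (P : PowerSeries R) :
    ∃ Q : PowerSeries R,
      HahnSeries.single (-1 : ℤ) (1 : R) ^ N * HahnSeries.ofPowerSeries ℤ R P =
        HahnSeries.single (-1 : ℤ) (1 : R) ^ (N + M) * HahnSeries.ofPowerSeries ℤ R Q ∧
      laxOf ℓ ^ N * HahnSeries.ofPowerSeries ℤ R (P.subst (laxInvOf ℓ)) =
        laxOf ℓ ^ (N + M) * HahnSeries.ofPowerSeries ℤ R (Q.subst (laxInvOf ℓ)) := by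
  have h1 : HahnSeries.single (-1 : ℤ) (1 : R) * HahnSeries.ofPowerSeries ℤ R PowerSeries.X = 1 := by
    rw [HahnSeries.ofPowerSeries_X, HahnSeries.single_mul_single]
    simp
  have hs := hasSubst_laxInvOf ℓ
  refine ⟨PowerSeries.X ^ M * P, ?_, ?_⟩
  · rw [map_mul, map_pow, pow_add, mul_assoc, ← mul_assoc (_ ^ M), ← mul_pow, h1, one_pow, one_mul]
  · rw [PowerSeries.subst_mul hs, PowerSeries.subst_pow hs, PowerSeries.subst_X hs, map_mul,
      map_pow, pow_add, mul_assoc, ← mul_assoc (_ ^ M), ← mul_pow, laxOf_mul_laxInvOf hℓ, one_pow,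
      one_mul]

theorem add (hℓ : PowerSeries.constantCoeff ℓ = 1) (hf : IsComposition ℓ f f')
    (hg : IsComposition ℓ g g') : IsComposition ℓ (f + g) (f' + g') := by
  obtain ⟨N, P, rfl, rfl⟩ := hf
  obtain ⟨M, Q, rfl, rfl⟩ := hg
  obtain ⟨P', h1, h2⟩ := exists_add hℓ N M P
  obtain ⟨Q', h3, h4⟩ := exists_add hℓ M N Q
  refine ⟨N + M, P' + Q', ?_, ?_⟩
  · rw [h1, h3, map_add, add_comm M N, mul_add]
  · rw [h2, h4, PowerSeries.subst_add (hasSubst_laxInvOf ℓ), map_add, add_comm M N, mul_add]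

theorem sum (hℓ : PowerSeries.constantCoeff ℓ = 1) {ι : Type*} (s : Finset ι)
    {F F' : ι → LaurentSeries R} (h : ∀ i ∈ s, IsComposition ℓ (F i) (F' i)) :
    IsComposition ℓ (∑ i ∈ s, F i) (∑ i ∈ s, F' i) := by
  classical
  induction s using Finset.induction_on with
  | empty => simpa using C (ℓ := ℓ) 0
  | insert a s ha ih =>
    rw [Finset.sum_insert ha, Finset.sum_insert ha]
    exact add hℓ (h a (Finset.mem_insert_self a s))
      (ih fun i hi => h i (Finset.mem_insert_of_mem hi))

end IsComposition

variable [Algebra ℚ R]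

theorem natCast_add_one_eq_C (n : ℕ) :
    ((n : LaurentSeries R) + 1) = HahnSeries.C (algebraMap ℚ R (n + 1)) := by
  rw [map_add, map_add, map_one, map_one, map_natCast, map_natCast]

theorem der_const_algebraMap_inv (D : Der (LaurentSeries R)) {n : ℕ} (hn : n ≠ 0) :
    D (HahnSeries.C (algebraMap ℚ R (1 / n))) = 0 := by
  refine D.map_eq_zero_of_natCast_mul_eq_one (n := n) ?_
  rw [← map_natCast (HahnSeries.C : R →+* LaurentSeries R), ← map_mul,
    ← map_natCast (algebraMap ℚ R), ← map_mul, mul_one_div_cancel (by exact_mod_cast hn), map_one,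
    map_one]

/-- Differentiation lowers the truncation order of the exponential by one, because `(n + 1) / (n +
1)! = 1 / n!`. -/
theorem der_exp_sum (D : Der (LaurentSeries R)) (z : LaurentSeries R) (N : ℕ) :
    D (∑ n ∈ Finset.range (N + 1), HahnSeries.C (PowerSeries.coeff n (PowerSeries.exp R)) * z ^ n) =
      (∑ n ∈ Finset.range N, HahnSeries.C (PowerSeries.coeff n (PowerSeries.exp R)) * z ^ n) *
        D z := by
  have h0 : ∀ n : ℕ, D (HahnSeries.C (PowerSeries.coeff n (PowerSeries.exp R))) = 0 := fun n => by
    rw [PowerSeries.coeff_exp]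
    exact der_const_algebraMap_inv D n.factorial_ne_zero
  rw [map_sum, Finset.sum_range_succ', Finset.sum_mul]
  have h1 : D (HahnSeries.C (PowerSeries.coeff 0 (PowerSeries.exp R)) * z ^ 0) = 0 := by
    rw [pow_zero, mul_one, h0]
  rw [h1, add_zero]
  refine Finset.sum_congr rfl fun n _ => ?_
  have h2 : HahnSeries.C (PowerSeries.coeff (n + 1) (PowerSeries.exp R)) *
      ((n : LaurentSeries R) + 1) = HahnSeries.C (PowerSeries.coeff n (PowerSeries.exp R)) := by
    rw [natCast_add_one_eq_C, ← map_mul, PowerSeries.coeff_exp, PowerSeries.coeff_exp, ← map_mul]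
    congr 2
    rw [Nat.factorial_succ]
    push_cast
    have : (n : ℚ) + 1 ≠ 0 := by positivity
    field_simp
  rw [Der.leibniz, h0, mul_zero, add_zero, Der.map_pow_succ, ← h2]
  ring

/-- The chain rule for the formal exponential series. -/
theorem der_exp_subst {D : Der (LaurentSeries R)} (hD : IsLocalDer D) {y : PowerSeries R}
    (hy : PowerSeries.constantCoeff y = 0) :
    D (HahnSeries.ofPowerSeries ℤ R ((PowerSeries.exp R).subst y)) =
      HahnSeries.ofPowerSeries ℤ R ((PowerSeries.exp R).subst y) *
        D (HahnSeries.ofPowerSeries ℤ R y) := by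
  ext j
  obtain ⟨N, hN⟩ : ∃ N : ℕ, j < N := ⟨(j + 1).toNat, by omega⟩
  have ho : ∀ Q : PowerSeries R, ∀ i < (0 : ℤ), (HahnSeries.ofPowerSeries ℤ R Q).coeff i = 0 :=
    fun Q i hi => ofPowerSeries_coeff_of_neg Q hi
  -- The left side is cut one order later than the right side, since `D` maps the longer partial sum
  -- to the shorter one times `D y`. Both remainders have order at least `N > j` and do not affect
  -- the coefficient of index `j`.
  obtain ⟨Q, hQ⟩ := exists_subst_eq_sum_add hy (N + 1) (PowerSeries.exp R)
  obtain ⟨Q', hQ'⟩ := exists_subst_eq_sum_add hy N (PowerSeries.exp R)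
  have e : ∀ (n : ℕ) (Z : PowerSeries R), HahnSeries.ofPowerSeries ℤ R
      (∑ m ∈ Finset.range n, PowerSeries.C (PowerSeries.coeff m (PowerSeries.exp R)) * y ^ m + Z) =
      ∑ m ∈ Finset.range n, HahnSeries.C (PowerSeries.coeff m (PowerSeries.exp R)) *
        HahnSeries.ofPowerSeries ℤ R y ^ m + HahnSeries.ofPowerSeries ℤ R Z := fun n Z => by
    simp only [map_add, map_sum, map_mul, map_pow, HahnSeries.ofPowerSeries_C]
  have h1 := congrArg (HahnSeries.ofPowerSeries ℤ R) hQ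
  have h2 := congrArg (HahnSeries.ofPowerSeries ℤ R) hQ'
  rw [e] at h1 h2
  conv_lhs => rw [h1, map_add, der_exp_sum]
  rw [h2, add_mul, HahnSeries.coeff_add, HahnSeries.coeff_add]
  congr 1
  rw [hD N _ (fun i hi => ofPowerSeries_pow_mul_coeff_of_lt hy (N + 1) Q (by push_cast; omega)) j hN]
  exact (coeff_mul_eq_zero_of_lt (p := N) (q := 0)
    (fun i hi => ofPowerSeries_pow_mul_coeff_of_lt hy N Q' hi)
    (hD 0 _ (ho y)) (by omega)).symm

/-! ### Change of variables in the residue -/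

/-- `A^m ∂A` is the derivative of `A^{m+1} / (m+1)`; the division uses the rational coefficients. -/
theorem residue_pow_mul_kDerivation (A : LaurentSeries R) (m : ℕ) :
    (A ^ m * kDerivation A).coeff 1 = 0 := by
  have h := kDerivation_coeff_one (A ^ (m + 1))
  rw [Der.map_pow_succ, mul_assoc, natCast_add_one_eq_C, coeff_C_mul] at h
  have h2 : algebraMap ℚ R (1 / (m + 1)) * algebraMap ℚ R (m + 1) = 1 := by
    rw [← map_mul, one_div_mul_cancel (by positivity), map_one]
  calc _ = (algebraMap ℚ R (1 / (m + 1)) * algebraMap ℚ R (m + 1)) *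
        (A ^ m * kDerivation A).coeff 1 := by rw [h2, one_mul]
    _ = 0 := by rw [mul_assoc, h, mul_zero]

/-- `res f(λ) dλ = res f(L) ∂L/∂k dk`. -/
theorem IsComposition.residue_eq {ℓ : PowerSeries R} (hℓ : PowerSeries.constantCoeff ℓ = 1)
    {f f' : LaurentSeries R} (h : IsComposition ℓ f f') :
    f.coeff 1 = (f' * kDerivation (laxOf ℓ)).coeff 1 := by
  obtain ⟨N, P, rfl, rfl⟩ := h
  have hl : (HahnSeries.single (-1 : ℤ) (1 : R) ^ N * HahnSeries.ofPowerSeries ℤ R P).coeff 1 =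
      PowerSeries.coeff (N + 1) P := by
    rw [HahnSeries.single_pow, one_pow, HahnSeries.coeff_single_mul, one_mul,
      ← ofPowerSeries_coeff_natCast]
    congr 1
    push_cast
    simp
    ring
  -- After multiplication by `L^N ∂ₖL`, the terms with `n ≤ N` are `L^{N-n} ∂ₖL` and have no
  -- residue. The term `n = N + 1` is `L⁻¹ ∂ₖL`, of residue `1`. The remainder carries `L⁻²` and
  -- starts at `k⁻²`.
  obtain ⟨Q, hQ⟩ := exists_subst_eq_sum_add (constantCoeff_laxInvOf ℓ) (N + 2) P
  set w := HahnSeries.ofPowerSeries ℤ R (laxInvOf ℓ) with hw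
  set L := laxOf ℓ with hL
  have hLw : L * w = 1 := laxOf_mul_laxInvOf hℓ
  have hLw' : ∀ n m : ℕ, L ^ n * w ^ (n + m) = w ^ m := fun n m => by
    rw [pow_add, ← mul_assoc, ← mul_pow, hLw, one_pow, one_mul]
  have hterm : ∀ n ∈ Finset.range (N + 1),
      (HahnSeries.C (PowerSeries.coeff n P) * (L ^ N * w ^ n * kDerivation L)).coeff 1 = 0 := by
    intro n hn
    obtain ⟨m, rfl⟩ := Nat.exists_eq_add_of_le (Nat.lt_succ_iff.1 (Finset.mem_range.1 hn))
    have : L ^ (n + m) * w ^ n = L ^ m := by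
      rw [pow_add, mul_right_comm, ← mul_pow, hLw, one_pow, one_mul]
    rw [coeff_C_mul, this, residue_pow_mul_kDerivation, mul_zero]
  have hrest : (w ^ 2 * HahnSeries.ofPowerSeries ℤ R Q * kDerivation L).coeff 1 = 0 := by
    rw [hw, ← map_pow, ← map_mul]
    exact coeff_mul_eq_zero_of_lt (p := 2) (q := 0)
      (fun j hj => ofPowerSeries_pow_mul_coeff_of_lt (constantCoeff_laxInvOf ℓ) 2 Q
        (by exact_mod_cast hj))
      (fun j hj => coeff_kDerivation_laxOf_of_neg ℓ hj) (by omega)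
  have key : L ^ N * HahnSeries.ofPowerSeries ℤ R (P.subst (laxInvOf ℓ)) * kDerivation L =
      ∑ n ∈ Finset.range (N + 1),
        HahnSeries.C (PowerSeries.coeff n P) * (L ^ N * w ^ n * kDerivation L) +
      HahnSeries.C (PowerSeries.coeff (N + 1) P) * (w * kDerivation L) +
      w ^ 2 * HahnSeries.ofPowerSeries ℤ R Q * kDerivation L := by
    rw [hQ, Finset.sum_range_succ _ (N + 1)]
    simp only [map_add, map_sum, map_mul, map_pow, HahnSeries.ofPowerSeries_C, ← hw]
    have h1 := hLw' N 1
    have h2 := hLw' N 2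
    rw [pow_one] at h1
    rw [mul_add, mul_add, Finset.mul_sum, add_mul, add_mul, Finset.sum_mul]
    congr 1
    · congr 1
      · exact Finset.sum_congr rfl fun n _ => by ring
      · linear_combination
          (HahnSeries.C (PowerSeries.coeff (N + 1) P) * kDerivation L) * h1
    · linear_combination (HahnSeries.ofPowerSeries ℤ R Q * kDerivation L) * h2
  rw [hl, key, HahnSeries.coeff_add, HahnSeries.coeff_add, hrest, HahnSeries.coeff_sum,
    Finset.sum_eq_zero hterm, coeff_C_mul, residue_laxInvOf_mul hℓ]
  simp

end Substitution

/-! ### Differential forms over a ring with four commuting derivations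

The indices `0, 1, 2, 3` stand for `k, x, θ₁, θ₂`. -/

section Forms

variable {K : Type*} [CommRing K]

/-- The Poisson bracket in terms of the differentials of its arguments. -/
def poisson (a b : Fin 4 → K) : K := a 0 * b 1 - a 1 * b 0 + a 2 * b 3 - a 3 * b 2

/-- The coefficient of `dk ∧ dθ₁ ∧ dθ₂` in `a ∧ b ∧ c`. -/
def wedge3 (a b c : Fin 4 → K) : K :=
  a 0 * (b 2 * c 3 - b 3 * c 2) - a 2 * (b 0 * c 3 - b 3 * c 0) + a 3 * (b 0 * c 2 - b 2 * c 0)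

/-- If `(l, m, u, v)` is a symplectic coframe, then
`l ∧ m + u ∧ v = dk ∧ dx + dθ₁ ∧ dθ₂`. -/
theorem symplectic_coframe {l m u v : Fin 4 → K} (hlm : poisson l m = 1) (huv : poisson u v = 1)
    (hlu : poisson l u = 0) (hlv : poisson l v = 0) (hmu : poisson m u = 0)
    (hmv : poisson m v = 0) (i j : Fin 4) :
    l i * m j - m i * l j + u i * v j - v i * u j =
      (!![0, 1, 0, 0; -1, 0, 0, 0; 0, 0, 0, 1; 0, 0, -1, 0] : Matrix (Fin 4) (Fin 4) K) i j := by
  set Ω : Matrix (Fin 4) (Fin 4) K := !![0, 1, 0, 0; -1, 0, 0, 0; 0, 0, 0, 1; 0, 0, -1, 0] with hΩ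
  set P : Matrix (Fin 4) (Fin 4) K := !![l 0, l 1, l 2, l 3; m 0, m 1, m 2, m 3;
    u 0, u 1, u 2, u 3; v 0, v 1, v 2, v 3] with hP
  -- The six bracket relations say `P Ω Pᵀ = Ω`, so the rows of `P` form a symplectic frame. A right
  -- inverse of a square matrix is also a left inverse, which gives the transposed relation `Pᵀ Ω P
  -- = Ω`, whose entries are the claim.
  have h1 : P * (Ω * P.transpose * -Ω) = 1 := by
    have : P * Ω * P.transpose = Ω := by
      ext a b
      simp only [poisson] at *
      fin_cases a <;> fin_cases b <;>
        simp [hP, hΩ, Matrix.mul_apply, Fin.sum_univ_four] <;>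
        first | ring1 | linear_combination hlm | linear_combination -hlm | linear_combination huv |
          linear_combination -huv | linear_combination hlu | linear_combination -hlu |
          linear_combination hlv | linear_combination -hlv | linear_combination hmu |
          linear_combination -hmu | linear_combination hmv | linear_combination -hmv
    rw [← mul_assoc, ← mul_assoc, this]
    ext a b
    fin_cases a <;> fin_cases b <;> simp [hΩ, Matrix.mul_apply, Fin.sum_univ_four]
  have h2 : Ω * P.transpose * -Ω * P = 1 := mul_eq_one_comm.1 h1
  have h3 : Ω * Ω = -1 := by
    ext a b
    fin_cases a <;> fin_cases b <;> simp [hΩ, Matrix.mul_apply, Fin.sum_univ_four]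
  have h4 : P.transpose * Ω * P = Ω := by
    have := congrArg (Ω * ·) h2
    simp only [mul_one, mul_neg, neg_mul] at this
    rw [← mul_assoc, ← mul_assoc, ← mul_assoc, h3] at this
    simpa using this
  have h5 := congrFun (congrFun h4 i) j
  rw [← h5]
  fin_cases i <;> fin_cases j <;> simp [hP, hΩ, Matrix.mul_apply, Fin.sum_univ_four] <;> ring

/-- At constant `x` the form `dk ∧ dx + dθ₁ ∧ dθ₂` reduces to `dθ₁ ∧ dθ₂`, whose wedge with `w` sees
only the `dk`-component of `w`. -/
theorem wedge3_add_wedge3 {l m u v : Fin 4 → K} (hlm : poisson l m = 1) (huv : poisson u v = 1)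
    (hlu : poisson l u = 0) (hlv : poisson l v = 0) (hmu : poisson m u = 0)
    (hmv : poisson m v = 0) (w : Fin 4 → K) : wedge3 w l m + wedge3 w u v = w 0 := by
  have h := symplectic_coframe hlm huv hlu hlv hmu hmv
  have h23 := h 2 3
  have h02 := h 0 2
  have h03 := h 0 3
  simp at h23 h02 h03
  simp only [wedge3]
  linear_combination w 0 * h23 - w 2 * h03 + w 3 * h02

variable (δ : Fin 4 → Der K)

/-- The differential of a ring element. -/
def differential (a : K) : Fin 4 → K := fun i => δ i a

/-- Closedness of a `1`-form, restricted to constant `x`. -/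
structure IsClosedForm (w : Fin 4 → K) : Prop where
  d02 : δ 0 (w 2) = δ 2 (w 0)
  d03 : δ 0 (w 3) = δ 3 (w 0)
  d23 : δ 2 (w 3) = δ 3 (w 2)

variable {δ}

theorem isClosedForm_differential (hδ : ∀ i j a, δ i (δ j a) = δ j (δ i a)) (a : K) :
    IsClosedForm δ (differential δ a) :=
  ⟨hδ _ _ _, hδ _ _ _, hδ _ _ _⟩

/-- If `dE = c E w` with `w` closed, then `E w` is closed. -/
theorem IsClosedForm.exp_mul {w : Fin 4 → K} (hw : IsClosedForm δ w) {E c : K}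
    (hE : ∀ i, δ i E = c * E * w i) : IsClosedForm δ (fun i => E * w i) := by
  constructor
  · simp only [Der.leibniz, hE, hw.d02]; ring
  · simp only [Der.leibniz, hE, hw.d03]; ring
  · simp only [Der.leibniz, hE, hw.d23]; ring

variable {G : Type*} [AddCommGroup G] {I : K →+ G}

/-- Stokes' theorem. -/
theorem integral_wedge3_eq_zero (hI0 : ∀ a, I (δ 0 a) = 0) (hI2 : ∀ a, I (δ 2 a) = 0)
    (hI3 : ∀ a, I (δ 3 a) = 0) (a : K) {w w' : Fin 4 → K} (hw : IsClosedForm δ w)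
    (hw' : IsClosedForm δ w') : I (wedge3 (differential δ a) w w') = 0 := by
  -- This is `da ∧ w ∧ w' = d(a w ∧ w')`, valid because `w` and `w'` are closed.
  have h : wedge3 (differential δ a) w w' = δ 0 (a * (w 2 * w' 3 - w 3 * w' 2)) -
      δ 2 (a * (w 0 * w' 3 - w 3 * w' 0)) + δ 3 (a * (w 0 * w' 2 - w 2 * w' 0)) := by
    simp only [wedge3, differential, Der.leibniz, map_sub, hw.d02, hw.d03, hw.d23, hw'.d02, hw'.d03,
      hw'.d23]
    ring
  rw [h, map_add, map_sub, hI0, hI2, hI3, sub_zero, add_zero]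

/-- `∫ res (∂T/∂k) T' = 0` for `T = Lⁿ E`, `T' = Lⁿ' E'`, where `E` and `E'` are exponentials of
multiples of `U`. -/
theorem integral_deriv_mul_eq_zero [IsAddTorsionFree G] (hδ : ∀ i j a, δ i (δ j a) = δ j (δ i a))
    (hI0 : ∀ a, I (δ 0 a) = 0) (hI2 : ∀ a, I (δ 2 a) = 0) (hI3 : ∀ a, I (δ 3 a) = 0)
    {L M : K} {u v : Fin 4 → K} (hu : IsClosedForm δ u) (hv : IsClosedForm δ v)
    (hlm : poisson (differential δ L) (differential δ M) = 1) (huv : poisson u v = 1)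
    (hlu : poisson (differential δ L) u = 0) (hlv : poisson (differential δ L) v = 0)
    (hmu : poisson (differential δ M) u = 0) (hmv : poisson (differential δ M) v = 0)
    {E E' c c' : K} (hc : ∀ i, δ i c = 0) (hE : ∀ i, δ i E = c * E * u i)
    (hE' : ∀ i, δ i E' = c' * E' * u i) (n n' : ℕ) :
    I (δ 0 (L ^ n * E) * (L ^ n' * E')) = 0 := by
  have hw := wedge3_add_wedge3 hlm huv hlu hlv hmu hmv
  have hEE : ∀ i, δ i (E * E') = (c + c') * (E * E') * u i := fun i => by
    rw [Der.leibniz, hE, hE']; ring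
  have hcl := hu.exp_mul hEE
  -- In the frame identity for `w = dL` the term `dL ∧ dL ∧ dM` drops out. For `w = u`, in `hUu`
  -- below, the term `u ∧ u ∧ v` does.
  have hLu : ∀ a, δ 0 L * a = a * wedge3 (differential δ L) u v := fun a => by
    have := hw (differential δ L)
    simp only [wedge3, differential] at this ⊢
    linear_combination -a * this
  have hUu : ∀ a, u 0 * a = a * wedge3 (differential δ L) (differential δ M) u := fun a => by
    have := hw u
    simp only [wedge3, differential] at this ⊢
    linear_combination -a * this
  have hpow : ∀ i, ∀ m : ℕ, δ i (L ^ (m + 1)) = (m + 1) * L ^ m * δ i L :=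
    fun i m => (δ i).map_pow_succ L m
  -- Stokes for `d(c L^{n+n'+1}) ∧ dM ∧ (E E' u)`. The last factor is closed since `E E'` is again
  -- an exponential of `U`. The integer factor produced by the power of `L` cancels because `G` is
  -- torsion free.
  have h2 : I (c * L ^ (n + n') * (E * E') * u 0) = 0 := by
    have h := integral_wedge3_eq_zero hI0 hI2 hI3 (c * L ^ (n + n' + 1))
      (isClosedForm_differential hδ M) hcl
    have e : wedge3 (differential δ (c * L ^ (n + n' + 1))) (differential δ M)
        (fun i => E * E' * u i) = (n + n' + 1) • (c * L ^ (n + n') * (E * E') * u 0) := by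
      rw [mul_comm _ (u 0), hUu]
      simp only [wedge3, differential, Der.leibniz, hc, hpow, nsmul_eq_mul]
      push_cast
      ring
    rw [e, map_nsmul] at h
    exact (smul_eq_zero_iff_right (by omega)).1 h
  cases n with
  | zero =>
    have e : δ 0 (L ^ 0 * E) * (L ^ n' * E') = c * L ^ (0 + n') * (E * E') * u 0 := by
      rw [pow_zero, one_mul, hE, zero_add]
      ring
    rw [e, h2]
  | succ m =>
    -- Stokes for `d(L^{m+n'+1}) ∧ (E E' u) ∧ v`.
    have h1 : I (L ^ (m + n') * (E * E') * δ 0 L) = 0 := by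
      have h := integral_wedge3_eq_zero hI0 hI2 hI3 (L ^ (m + n' + 1)) hcl hv
      have e : wedge3 (differential δ (L ^ (m + n' + 1))) (fun i => E * E' * u i) v =
          (m + n' + 1) • (L ^ (m + n') * (E * E') * δ 0 L) := by
        rw [mul_comm _ (δ 0 L), hLu]
        simp only [wedge3, differential, hpow, nsmul_eq_mul]
        push_cast
        ring
      rw [e, map_nsmul] at h
      exact (smul_eq_zero_iff_right (by omega)).1 h
    have e : δ 0 (L ^ (m + 1) * E) * (L ^ n' * E') =
        (m + 1) • (L ^ (m + n') * (E * E') * δ 0 L) +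
          c * L ^ (m + 1 + n') * (E * E') * u 0 := by
      rw [Der.leibniz, hE, hpow, nsmul_eq_mul]
      push_cast
      ring
    rw [e, map_add, map_nsmul, h1, h2, smul_zero, add_zero]

/-- The variation of `∫ res Lⁿ E M (∂L/∂k)` under the flow of the Hamiltonian `B`. -/
theorem integral_flow_eq (hδ : ∀ i j a, δ i (δ j a) = δ j (δ i a))
    (hI0 : ∀ a, I (δ 0 a) = 0) (hI2 : ∀ a, I (δ 2 a) = 0) (hI3 : ∀ a, I (δ 3 a) = 0)
    {L M : K} {u : Fin 4 → K} (hlm : poisson (differential δ L) (differential δ M) = 1)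
    (hlu : poisson (differential δ L) u = 0)
    {E c : K} (hE : ∀ i, δ i E = c * E * u i) (n : ℕ) {D : Der K} (hD : ∀ a, D (δ 0 a) = δ 0 (D a))
    {B : K} (hDL : D L = poisson (differential δ B) (differential δ L))
    (hDM : D M = poisson (differential δ B) (differential δ M))
    (hDE : D E = c * E * poisson (differential δ B) u) :
    I (D (L ^ n * E * M * δ 0 L)) = I (δ 0 B * (L ^ n * E)) := by
  -- One factor `p`, which is `n L^{n-1}`, serves all derivations at once and confines the case `n =
  -- 0` to this line.
  obtain ⟨p, hp⟩ : ∃ p : K, ∀ D' : Der K, D' (L ^ n) = p * D' L := by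
    cases n with
    | zero => exact ⟨0, by simp⟩
    | succ m => exact ⟨_, fun D' => D'.map_pow_succ L m⟩
  set X := L ^ n * E * M with hX
  have hDX : D X = poisson (differential δ B) (differential δ X) := by
    simp only [hX, Der.leibniz, hp, hDL, hDM, hDE, poisson, differential, hE]
    ring
  have hLX : poisson (differential δ L) (differential δ X) = L ^ n * E := by
    simp only [poisson, differential] at hlm hlu ⊢
    simp only [hX, Der.leibniz, hp, hE]
    linear_combination L ^ n * E * hlm + L ^ n * M * c * E * hlu
  -- The term `X ∂ₖ(DL)` is integrated by parts. What remains is the algebraic identity `∂ₖL {B,X} -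
  -- ∂ₖX {B,L} = ∂ₖB {L,X} - dB∧dL∧dX`, with the 3-form taken at constant `x`.
  have e : D (X * δ 0 L) = δ 0 B * (L ^ n * E) -
      wedge3 (differential δ B) (differential δ L) (differential δ X) + δ 0 (X * D L) := by
    rw [Der.leibniz D, Der.leibniz (δ 0), hD, hDX, hDL, ← hLX]
    simp only [poisson, wedge3, differential]
    ring
  rw [e, map_add, map_sub, hI0, integral_wedge3_eq_zero hI0 hI2 hI3 B
    (isClosedForm_differential hδ L) (isClosedForm_differential hδ X), sub_zero, add_zero]

end Forms

/-! ### The algebra of regular functions -/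

section RegularFunctions

/-- The coordinate subspace of `(t, x)`-space on which only the times in `S` are nonzero. -/
abbrev Params (S : Finset (ℕ × ℤ)) := (S → ℂ) × ℂ

/-- The space of the variables `(t, x, θ)`. -/
abbrev Phase (S : Finset (ℕ × ℤ)) := Params S × ℝ × ℝ

variable {S : Finset (ℕ × ℤ)} (W : TopologicalSpace.Opens (Params S))

/-- The domain of the variables `(t, x, θ)`, `(t, x) ∈ W`. -/
def phaseDomain : Set (Phase S) := {p | p.1 ∈ W}

theorem isOpen_phaseDomain : IsOpen (phaseDomain W) := W.isOpen.preimage continuous_fst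

variable {W}

open Classical in
/-- Extension by zero. -/
def extend (f : phaseDomain W → ℂ) (p : Phase S) : ℂ := if h : p ∈ phaseDomain W then f ⟨p, h⟩ else 0

theorem extend_of_mem (f : phaseDomain W → ℂ) {p : Phase S} (h : p ∈ phaseDomain W) :
    extend f p = f ⟨p, h⟩ := dif_pos h

theorem extend_of_notMem (f : phaseDomain W → ℂ) {p : Phase S} (h : p ∉ phaseDomain W) :
    extend f p = 0 := dif_neg h

@[simp] theorem extend_coe (f : phaseDomain W → ℂ) (p : phaseDomain W) : extend f p = f p :=
  extend_of_mem f p.2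

theorem extend_restrict_eventuallyEq {F : Phase S → ℂ} {p : Phase S} (hp : p ∈ phaseDomain W) :
    extend (W := W) (fun q => F q) =ᶠ[nhds p] F := by
  filter_upwards [(isOpen_phaseDomain W).mem_nhds hp] with q hq
  rw [extend_of_mem _ hq]

theorem extend_add (f g : phaseDomain W → ℂ) : extend (f + g) = extend f + extend g := by
  ext p
  by_cases h : p ∈ phaseDomain W
  · simp [extend_of_mem _ h]
  · simp [extend_of_notMem _ h]

theorem extend_mul (f g : phaseDomain W → ℂ) : extend (f * g) = extend f * extend g := by
  ext p
  by_cases h : p ∈ phaseDomain W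
  · simp [extend_of_mem _ h]
  · simp [extend_of_notMem _ h]

/-- The functions of `(t, x, θ)`, `(t, x) ∈ W`, that are smooth, holomorphic in `(t, x)` and doubly
periodic in `θ`. -/
structure IsRegularFun (f : phaseDomain W → ℂ) : Prop where
  smooth : ∀ p ∈ phaseDomain W, ContDiffAt ℝ ∞ (extend f) p
  cauchyRiemann : ∀ p ∈ phaseDomain W, ∀ v : Params S,
    fderiv ℝ (extend f) p (Complex.I • v, 0) = Complex.I * fderiv ℝ (extend f) p (v, 0)
  periodic₁ : ∀ p, extend f (p + (0, 2 * Real.pi, 0)) = extend f p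
  periodic₂ : ∀ p, extend f (p + (0, 0, 2 * Real.pi)) = extend f p

namespace IsRegularFun

variable {f g : phaseDomain W → ℂ}

theorem differentiableAt (hf : IsRegularFun f) {p : Phase S} (hp : p ∈ phaseDomain W) :
    DifferentiableAt ℝ (extend f) p := (hf.smooth p hp).differentiableAt (by simp)

theorem of_contDiffOn {F : Phase S → ℂ} (h1 : ContDiffOn ℝ ∞ F (phaseDomain W))
    (h2 : ∀ θ : ℝ × ℝ, DifferentiableOn ℂ (fun w => F (w, θ)) W)
    (h3 : ∀ p ∈ phaseDomain W, F (p + (0, 2 * Real.pi, 0)) = F p)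
    (h4 : ∀ p ∈ phaseDomain W, F (p + (0, 0, 2 * Real.pi)) = F p) :
    IsRegularFun (W := W) (fun q => F q) := by
  have hs : ∀ p ∈ phaseDomain W, ContDiffAt ℝ ∞ F p := fun p hp =>
    h1.contDiffAt ((isOpen_phaseDomain W).mem_nhds hp)
  have hper : ∀ c : ℝ × ℝ, (∀ p ∈ phaseDomain W, F (p + (0, c)) = F p) →
      ∀ p, extend (W := W) (fun q => F q) (p + (0, c)) = extend (W := W) (fun q => F q) p := by
    intro c hc p
    have hmem : p + (0, c) ∈ phaseDomain W ↔ p ∈ phaseDomain W := by simp [phaseDomain]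
    by_cases hp : p ∈ phaseDomain W
    · rw [extend_of_mem _ hp, extend_of_mem _ (hmem.2 hp)]
      exact hc p hp
    · rw [extend_of_notMem _ hp, extend_of_notMem _ (fun h => hp (hmem.1 h))]
  refine ⟨fun p hp => (hs p hp).congr_of_eventuallyEq (extend_restrict_eventuallyEq hp), ?_,
    hper _ h3, hper _ h4⟩
  intro p hp v
  rw [(extend_restrict_eventuallyEq hp).fderiv_eq]
  have hF : HasFDerivAt F (fderiv ℝ F p) (p.1, p.2) :=
    ((hs p hp).differentiableAt (by simp)).hasFDerivAt
  have e1 := hF.comp p.1 (hasFDerivAt_prodMk_left (𝕜 := ℝ) p.1 p.2)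
  have e2 := (((h2 p.2).differentiableAt (W.isOpen.mem_nhds hp)).hasFDerivAt).restrictScalars ℝ
  have e3 := e1.unique e2
  have e4 : ∀ u : Params S, fderiv ℝ F p (u, 0) = fderiv ℂ (fun w => F (w, p.2)) p.1 u := fun u =>
    DFunLike.congr_fun e3 u
  rw [e4, e4, map_smul, smul_eq_mul]

theorem const (c : ℂ) : IsRegularFun (W := W) (fun _ => c) :=
  of_contDiffOn (F := fun _ => c) contDiffOn_const (fun _ => differentiableOn_const c)
    (fun _ _ => rfl) (fun _ _ => rfl)

theorem add (hf : IsRegularFun f) (hg : IsRegularFun g) : IsRegularFun (f + g) := by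
  refine ⟨fun p hp => ?_, fun p hp v => ?_, fun p => ?_, fun p => ?_⟩
  · rw [extend_add]; exact (hf.smooth p hp).add (hg.smooth p hp)
  · rw [extend_add, fderiv_add (hf.differentiableAt hp) (hg.differentiableAt hp)]
    simp only [add_apply, hf.cauchyRiemann p hp, hg.cauchyRiemann p hp]
    ring
  · simp only [extend_add, Pi.add_apply, hf.periodic₁, hg.periodic₁]
  · simp only [extend_add, Pi.add_apply, hf.periodic₂, hg.periodic₂]

theorem mul (hf : IsRegularFun f) (hg : IsRegularFun g) : IsRegularFun (f * g) := by
  refine ⟨fun p hp => ?_, fun p hp v => ?_, fun p => ?_, fun p => ?_⟩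
  · rw [extend_mul]; exact (hf.smooth p hp).mul (hg.smooth p hp)
  · rw [extend_mul, fderiv_mul (hf.differentiableAt hp) (hg.differentiableAt hp)]
    simp only [add_apply, smul_apply, smul_eq_mul,
      hf.cauchyRiemann p hp, hg.cauchyRiemann p hp]
    ring
  · simp only [extend_mul, Pi.mul_apply, hf.periodic₁, hg.periodic₁]
  · simp only [extend_mul, Pi.mul_apply, hf.periodic₂, hg.periodic₂]

theorem contDiffAt_fderiv (hf : IsRegularFun f) {p : Phase S} (hp : p ∈ phaseDomain W) :
    ContDiffAt ℝ ∞ (fderiv ℝ (extend f)) p :=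
  (hf.smooth p hp).fderiv_right (by simp)

theorem fderiv_fderiv_apply (hf : IsRegularFun f) {p : Phase S} (hp : p ∈ phaseDomain W)
    (v w : Phase S) : fderiv ℝ (fun q => fderiv ℝ (extend f) q v) p w =
      fderiv ℝ (fderiv ℝ (extend f)) p w v := by
  rw [fderiv_clm_apply ((hf.contDiffAt_fderiv hp).differentiableAt (by simp))
    (differentiableAt_const v)]
  simp

theorem fderiv_fderiv_comm (hf : IsRegularFun f) {p : Phase S} (hp : p ∈ phaseDomain W)
    (v w : Phase S) : fderiv ℝ (fderiv ℝ (extend f)) p w v = fderiv ℝ (fderiv ℝ (extend f)) p v w :=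
  (hf.smooth p hp).isSymmSndFDerivAt
    (by rw [minSmoothness_of_isRCLikeNormedField]; exact ENat.LEInfty.out) w v

/-- Holomorphy is encoded as complex linearity of the real differential in `(t, x)`. By symmetry of
the second derivative this condition passes to every directional derivative, in `θ` as well as in
`(t, x)`; hence the algebra is stable under differentiation. -/
theorem fderiv_apply (hf : IsRegularFun f) (v : Phase S) :
    IsRegularFun (W := W) (fun p => fderiv ℝ (extend f) p v) := by
  have hper : ∀ c : ℝ × ℝ, (∀ p, extend f (p + (0, c)) = extend f p) →
      ∀ p, fderiv ℝ (extend f) (p + (0, c)) v = fderiv ℝ (extend f) p v := by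
    intro c hc p
    rw [← fderiv_comp_add_right]
    simp only [hc]
  have hmem : ∀ (p : Phase S) (c : ℝ × ℝ), p + (0, c) ∈ phaseDomain W ↔ p ∈ phaseDomain W := by
    simp [phaseDomain]
  have hper' : ∀ c : ℝ × ℝ, (∀ p, extend f (p + (0, c)) = extend f p) →
      ∀ p, extend (W := W) (fun p => fderiv ℝ (extend f) p v) (p + (0, c)) =
        extend (W := W) (fun p => fderiv ℝ (extend f) p v) p := by
    intro c hc p
    by_cases hp : p ∈ phaseDomain W
    · rw [extend_of_mem _ hp, extend_of_mem _ ((hmem p c).2 hp)]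
      exact hper c hc p
    · rw [extend_of_notMem _ hp, extend_of_notMem _ (fun h => hp ((hmem p c).1 h))]
  refine ⟨fun p hp => ?_, fun p hp u => ?_, hper' _ hf.periodic₁, hper' _ hf.periodic₂⟩
  · exact ((hf.contDiffAt_fderiv hp).clm_apply contDiffAt_const).congr_of_eventuallyEq
      (extend_restrict_eventuallyEq (F := fun q => fderiv ℝ (extend f) q v) hp)
  · rw [(extend_restrict_eventuallyEq (F := fun q => fderiv ℝ (extend f) q v) hp).fderiv_eq,
      hf.fderiv_fderiv_apply hp, hf.fderiv_fderiv_apply hp, hf.fderiv_fderiv_comm hp v,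
      hf.fderiv_fderiv_comm hp v, ← hf.fderiv_fderiv_apply hp (Complex.I • u, 0),
      ← hf.fderiv_fderiv_apply hp (u, 0)]
    have hev : (fun q => fderiv ℝ (extend f) q (Complex.I • u, 0)) =ᶠ[nhds p]
        fun q => Complex.I * fderiv ℝ (extend f) q (u, 0) := by
      filter_upwards [(isOpen_phaseDomain W).mem_nhds hp] with q hq
      exact hf.cauchyRiemann q hq u
    rw [hev.fderiv_eq, fderiv_const_mul]
    · simp
    · exact ((hf.contDiffAt_fderiv hp).clm_apply contDiffAt_const).differentiableAt (by simp)

end IsRegularFun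

variable (W) in
/-- The algebra of regular functions. -/
def regularAlgebra : Subalgebra ℂ (phaseDomain W → ℂ) where
  carrier := {f | IsRegularFun f}
  mul_mem' hf hg := hf.mul hg
  add_mem' hf hg := hf.add hg
  algebraMap_mem' c := IsRegularFun.const c

/-- The derivative of a regular function in a direction of the phase space. -/
def regularDer (v : Phase S) : Der (regularAlgebra W) where
  toFun f := ⟨fun p => fderiv ℝ (extend f.1) p v, f.2.fderiv_apply v⟩
  map_zero' := by
    ext p
    have : extend (W := W) 0 = fun _ => 0 := by
      ext p
      by_cases h : p ∈ phaseDomain W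
      · simp [extend_of_mem _ h]
      · simp [extend_of_notMem _ h]
    simp [this]
  map_add' f g := by
    ext p
    simp only [Subalgebra.coe_add, Pi.add_apply]
    rw [extend_add, fderiv_add (f.2.differentiableAt p.2) (g.2.differentiableAt p.2)]
    rfl
  leibniz' f g := by
    ext p
    simp only [Subalgebra.coe_add, Subalgebra.coe_mul, Pi.add_apply, Pi.mul_apply]
    rw [extend_mul, fderiv_mul (f.2.differentiableAt p.2) (g.2.differentiableAt p.2)]
    simp

theorem regularDer_apply (v : Phase S) (f : regularAlgebra W) (p : phaseDomain W) :
    (regularDer v f).1 p = fderiv ℝ (extend f.1) p v := rfl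

theorem regularDer_comm (v w : Phase S) (f : regularAlgebra W) :
    regularDer v (regularDer w f) = regularDer w (regularDer v f) := by
  have h : ∀ v w : Phase S, ∀ p : phaseDomain W, (regularDer v (regularDer w f)).1 p =
      fderiv ℝ (fderiv ℝ (extend f.1)) p v w := fun v w p => by
    rw [regularDer_apply, ← f.2.fderiv_fderiv_apply p.2]
    congr 1
    exact (extend_restrict_eventuallyEq (F := fun q => fderiv ℝ (extend f.1) q w) p.2).fderiv_eq
  ext p
  rw [h, h, f.2.fderiv_fderiv_comm p.2]

theorem hasFDerivAt_extend (f : regularAlgebra W) {p : Phase S} (hp : p ∈ phaseDomain W) :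
    HasFDerivAt (extend f.1) (fderiv ℝ (extend f.1) p) p :=
  (f.2.differentiableAt hp).hasFDerivAt

end RegularFunctions

/-! ### The average over the torus -/

section TorusMean

open MeasureTheory

theorem two_pi_nonneg : (0 : ℝ) ≤ 2 * Real.pi := by positivity

/-- The fundamental square of the torus. -/
def square : Set (ℝ × ℝ) := Set.Ioc 0 (2 * Real.pi) ×ˢ Set.Ioc 0 (2 * Real.pi)

theorem square_subset : square ⊆ Set.Icc 0 (2 * Real.pi) ×ˢ Set.Icc 0 (2 * Real.pi) :=
  Set.prod_mono Set.Ioc_subset_Icc_self Set.Ioc_subset_Icc_self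

theorem isCompact_closedSquare :
    IsCompact (Set.Icc (0 : ℝ) (2 * Real.pi) ×ˢ Set.Icc (0 : ℝ) (2 * Real.pi)) :=
  isCompact_Icc.prod isCompact_Icc

theorem integrableOn_square {E : Type*} [NormedAddCommGroup E] {f : ℝ × ℝ → E}
    (hf : Continuous f) : IntegrableOn f square :=
  (hf.continuousOn.integrableOn_compact isCompact_closedSquare).mono_set square_subset

theorem torusIntegral_eq {f : ℝ × ℝ → ℂ} (hf : Continuous f) :
    torusIntegral (fun a b => f (a, b)) = (1 / (2 * Real.pi : ℂ) ^ 2) * ∫ z in square, f z := by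
  rw [torusIntegral, intervalIntegral.integral_of_le two_pi_nonneg]
  simp only [intervalIntegral.integral_of_le two_pi_nonneg]
  congr 1
  exact (setIntegral_prod f (integrableOn_square hf)).symm

theorem torusIntegral_swap {f : ℝ × ℝ → ℂ} (hf : Continuous f) :
    torusIntegral (fun a b => f (a, b)) = torusIntegral (fun a b => f (b, a)) := by
  rw [torusIntegral, torusIntegral]
  congr 1
  have h := intervalIntegral_integral_swap (μ := volume.restrict (Set.Ioc 0 (2 * Real.pi)))
    (a := 0) (b := 2 * Real.pi) (f := fun a b => f (a, b)) (by
      rw [Set.uIoc_of_le two_pi_nonneg, Measure.prod_restrict]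
      exact integrableOn_square hf)
  simp only [← intervalIntegral.integral_of_le two_pi_nonneg] at h
  exact h

/-- The inner integral over a full period vanishes by the fundamental theorem of calculus. The
`θ₁`-derivative is reduced to this case by `torusIntegral_swap`. -/
theorem torusIntegral_deriv_right {f f' : ℝ → ℝ → ℂ} (hf : ∀ a b, HasDerivAt (f a) (f' a b) b)
    (hf' : ∀ a, Continuous (f' a)) (hper : ∀ a b, f a (b + 2 * Real.pi) = f a b) :
    torusIntegral f' = 0 := by
  have h : ∀ a, ∫ b in (0 : ℝ)..(2 * Real.pi), f' a b = 0 := fun a => by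
    rw [intervalIntegral.integral_eq_sub_of_hasDerivAt (fun b _ => hf a b)
      ((hf' a).intervalIntegrable _ _)]
    have := hper a 0
    rw [zero_add] at this
    rw [this, sub_self]
  simp [torusIntegral, h]

variable {S : Finset (ℕ × ℤ)} {W : TopologicalSpace.Opens (Params S)}

/-- The domain is a product with the whole `θ`-plane, so extension by zero never cuts a slice: each
is either smooth or identically zero. The torus mean is therefore additive at every `w`, even
outside `W`. -/
theorem continuous_extend (f : regularAlgebra W) (w : Params S) :
    Continuous fun θ : ℝ × ℝ => extend f.1 (w, θ) := by
  by_cases hw : w ∈ W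
  · refine continuous_iff_continuousAt.2 fun θ => ?_
    have h : ContinuousAt (extend f.1) (w, θ) := (f.2.smooth (w, θ) hw).continuousAt
    exact ContinuousAt.comp (f := fun θ : ℝ × ℝ => (w, θ)) h (by fun_prop)
  · have : ∀ θ : ℝ × ℝ, extend f.1 (w, θ) = 0 := fun θ => extend_of_notMem _ hw
    simp only [this]
    exact continuous_const

/-- The average of a regular function over the torus. -/
def torusMean (w : Params S) : regularAlgebra W →+ ℂ where
  toFun f := torusIntegral fun a b => extend f.1 (w, a, b)
  map_zero' := by
    have : extend (W := W) 0 = 0 := by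
      have h := extend_add (W := W) 0 0
      rw [add_zero] at h
      exact left_eq_add.1 h
    rw [Subalgebra.coe_zero, this]
    simp [torusIntegral]
  map_add' f g := by
    rw [torusIntegral_eq (continuous_extend _ w), torusIntegral_eq (continuous_extend _ w),
      torusIntegral_eq (continuous_extend _ w), ← mul_add,
      ← integral_add (integrableOn_square (continuous_extend f w))
        (integrableOn_square (continuous_extend g w)), Subalgebra.coe_add, extend_add]
    rfl

theorem torusMean_eq (w : Params S) (f : regularAlgebra W) : torusMean w f =
    (1 / (2 * Real.pi : ℂ) ^ 2) * ∫ z in square, extend f.1 (w, z) :=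
  torusIntegral_eq (continuous_extend f w)

theorem extend_regularDer (v : Phase S) (f : regularAlgebra W) {p : Phase S}
    (hp : p ∈ phaseDomain W) : extend (regularDer v f).1 p = fderiv ℝ (extend f.1) p v :=
  extend_of_mem _ hp

theorem hasDerivAt_extend_line (f : regularAlgebra W) {p : Phase S} (hp : p ∈ phaseDomain W)
    (v : Phase S) {γ : ℝ → Phase S} {s : ℝ} (hγ : HasDerivAt γ v s) (hs : γ s = p) :
    HasDerivAt (fun s => extend f.1 (γ s)) (extend (regularDer v f).1 p) s := by
  rw [extend_regularDer v f hp]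
  subst hs
  exact (hasFDerivAt_extend f hp).comp_hasDerivAt s hγ

theorem torusMean_regularDer_right {w : Params S} (hw : w ∈ W) (f : regularAlgebra W) :
    torusMean w (regularDer (0, 0, 1) f) = 0 := by
  refine torusIntegral_deriv_right (f := fun a b => extend f.1 (w, a, b)) (fun a b => ?_)
    (fun a => ?_) (fun a b => ?_)
  · exact hasDerivAt_extend_line f (p := (w, a, b)) hw _ (γ := fun b => (w, a, b))
      ((hasDerivAt_const _ _).prodMk ((hasDerivAt_const _ _).prodMk (hasDerivAt_id _))) rfl
  · exact (continuous_extend _ w).comp (Continuous.prodMk_right a)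
  · have h := f.2.periodic₂ (w, a, b)
    simpa using h

theorem torusMean_regularDer_left {w : Params S} (hw : w ∈ W) (f : regularAlgebra W) :
    torusMean w (regularDer (0, 1, 0) f) = 0 := by
  change torusIntegral _ = 0
  rw [torusIntegral_swap (f := fun z => extend (regularDer (0, 1, 0) f).1 (w, z))
    (continuous_extend _ w)]
  refine torusIntegral_deriv_right (f := fun b a => extend f.1 (w, a, b)) (fun b a => ?_)
    (fun b => ?_) (fun b a => ?_)
  · exact hasDerivAt_extend_line f (p := (w, a, b)) hw _ (γ := fun a => (w, a, b))
      ((hasDerivAt_const _ _).prodMk ((hasDerivAt_id _).prodMk (hasDerivAt_const _ _))) rfl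
  · exact (continuous_extend _ w).comp (Continuous.prodMk_left b)
  · have h := f.2.periodic₁ (w, a, b)
    simpa using h

/-- A real linear map that commutes with multiplication by `i` is complex linear. -/
theorem exists_restrictScalars_eq (A' : Params S →L[ℝ] ℂ)
    (hI : ∀ v, A' (Complex.I • v) = Complex.I * A' v) :
    ∃ A : Params S →L[ℂ] ℂ, A.restrictScalars ℝ = A' := by
  have hsmul : ∀ (c : ℂ) v, A' (c • v) = c • A' v := fun c v => by
    have h1 : c • v = c.re • v + c.im • (Complex.I • v) := by
      conv_lhs => rw [← Complex.re_add_im c, add_smul, mul_smul]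
      simp only [Complex.coe_smul]
    rw [h1, map_add, map_smul, map_smul, hI]
    conv_rhs => rw [← Complex.re_add_im c]
    simp only [Complex.real_smul, smul_eq_mul]
    ring
  exact ⟨{ toFun := A', map_add' := A'.map_add, map_smul' := hsmul, cont := A'.cont },
    by ext v <;> rfl⟩

theorem hasFDerivAt_extend_params (f : regularAlgebra W) {w : Params S} (hw : w ∈ W) (θ : ℝ × ℝ) :
    ∃ A : Params S →L[ℂ] ℂ, HasFDerivAt (fun w => extend f.1 (w, θ)) A w ∧
      ∀ v, A v = extend (regularDer (v, 0) f).1 (w, θ) := by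
  have hp : (w, θ) ∈ phaseDomain W := hw
  have h := HasFDerivAt.comp (f := fun w => (w, θ)) w (hasFDerivAt_extend f hp)
    (hasFDerivAt_prodMk_left (𝕜 := ℝ) w θ)
  obtain ⟨A, hA⟩ := exists_restrictScalars_eq ((fderiv ℝ (extend f.1) (w, θ)).comp
    (ContinuousLinearMap.inl ℝ (Params S) (ℝ × ℝ))) (fun v => f.2.cauchyRiemann _ hp v)
  refine ⟨A, hasFDerivAt_of_restrictScalars ℝ h hA, fun v => ?_⟩
  rw [extend_regularDer _ _ hp]
  exact DFunLike.congr_fun hA v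

/-- Differentiation under the integral sign. -/
theorem hasFDerivAt_torusMean {w : Params S} (hw : w ∈ W) (f : regularAlgebra W) :
    ∃ A : Params S →L[ℂ] ℂ, HasFDerivAt (fun w => torusMean w f) A w ∧
      ∀ v, A v = torusMean w (regularDer (v, 0) f) := by
  -- On the compact product of this ball with the closed square the derivative is bounded, and the
  -- bound is a constant dominating function.
  obtain ⟨ε, hε, hball⟩ := Metric.nhds_basis_closedBall.mem_iff.1 (W.isOpen.mem_nhds hw)
  set F' : Params S → ℝ × ℝ → Params S →L[ℝ] ℂ := fun w z =>
    (fderiv ℝ (extend f.1) (w, z)).comp (ContinuousLinearMap.inl ℝ (Params S) (ℝ × ℝ)) with hF'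
  have hcont : ContinuousOn (fun p : Phase S => F' p.1 p.2) (phaseDomain W) := fun p hp => by
    have h1 : ContinuousAt (fderiv ℝ (extend f.1)) p := (f.2.contDiffAt_fderiv hp).continuousAt
    exact (h1.clm_comp continuousAt_const).continuousWithinAt
  obtain ⟨C, hC⟩ := ((isCompact_closedBall w ε).prod isCompact_closedSquare).exists_bound_of_continuousOn
    (hcont.mono fun p hp => hball hp.1)
  have hF'w : Continuous (F' w) := by
    refine continuous_iff_continuousAt.2 fun z => ?_
    exact ContinuousAt.comp (f := fun z : ℝ × ℝ => (w, z))
      (hcont.continuousAt ((isOpen_phaseDomain W).mem_nhds (show (w, z) ∈ phaseDomain W from hw)))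
      (by fun_prop)
  have hmeas : ∀ᵐ z ∂(volume.restrict square), z ∈ square :=
    ae_restrict_mem (measurableSet_Ioc.prod measurableSet_Ioc)
  have key : HasFDerivAt (fun w => ∫ z in square, extend f.1 (w, z)) (∫ z in square, F' w z) w := by
    refine hasFDerivAt_integral_of_dominated_of_fderiv_le (bound := fun _ => C)
      (Metric.closedBall_mem_nhds w hε)
      (Filter.Eventually.of_forall fun w => (continuous_extend f w).aestronglyMeasurable)
      (integrableOn_square (continuous_extend f w)) hF'w.aestronglyMeasurable ?_
      (integrableOn_square continuous_const) ?_
    · filter_upwards [hmeas] with z hz w' hw'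
      exact hC (w', z) ⟨hw', square_subset hz⟩
    · filter_upwards with z w' hw'
      exact HasFDerivAt.comp (f := fun e => (e, z)) w'
        (hasFDerivAt_extend f (p := (w', z)) (hball hw'))
        (hasFDerivAt_prodMk_left (𝕜 := ℝ) w' z)
  set A' : Params S →L[ℝ] ℂ := (1 / (2 * Real.pi : ℂ) ^ 2) • ∫ z in square, F' w z with hA'
  have hmean : HasFDerivAt (fun w => torusMean w f) A' w := by
    simp only [torusMean_eq]
    exact key.const_smul (1 / (2 * Real.pi : ℂ) ^ 2)
  have happ : ∀ v, A' v = torusMean w (regularDer (v, 0) f) := fun v => by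
    rw [hA', torusMean_eq, smul_apply, smul_eq_mul,
      ContinuousLinearMap.integral_apply (integrableOn_square hF'w)]
    congr 2
    ext z
    rw [extend_regularDer _ _ (show (w, z) ∈ phaseDomain W from hw)]
    rfl
  -- The Cauchy–Riemann relation passes under the integral, which upgrades the real derivative of
  -- the mean to a complex one.
  have hI : ∀ v, A' (Complex.I • v) = Complex.I * A' v := fun v => by
    rw [happ, happ, torusMean_eq, torusMean_eq, mul_left_comm,
      ← integral_const_mul Complex.I]
    congr 1
    refine integral_congr_ae (ae_of_all _ fun z => ?_)
    have hz : (w, z) ∈ phaseDomain W := hw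
    simp only
    rw [extend_regularDer _ _ hz, extend_regularDer _ _ hz, f.2.cauchyRiemann _ hz]
  obtain ⟨A, hA⟩ := exists_restrictScalars_eq A' hI
  exact ⟨A, hasFDerivAt_of_restrictScalars ℝ hmean hA, fun v => by
    rw [← happ, ← hA, ContinuousLinearMap.coe_restrictScalars']⟩

end TorusMean

/-! ### The dependent variables over an arbitrary coefficient ring -/

/-- The coefficients from which `L`, `M`, `U` and `V` are built: the times `τ`, the constants
`c α = iα`, the exponentials `e α = exp (iαθ₁)`, the variable `x` and the fields. -/
@[ext]
structure Symbols (R : Type*) where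
  τ : ℕ × ℤ → R
  c : ℤ → R
  e : ℤ → R
  x : R
  g : ℕ → R
  h : ℕ → R
  u : ℕ → R
  v : ℕ → R

namespace Symbols

variable {R R' : Type*} [CommRing R] [CommRing R'] (d : Symbols R) (φ : R →+* R')

/-- Change of coefficients. -/
def map : Symbols R' :=
  ⟨φ ∘ d.τ, φ ∘ d.c, φ ∘ d.e, φ d.x, φ ∘ d.g, φ ∘ d.h, φ ∘ d.u, φ ∘ d.v⟩

/-- `L / k`. -/
def ell : PowerSeries R := 1 + PowerSeries.X ^ 2 * PowerSeries.mk d.g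

/-- `L`. -/
def lax : LaurentSeries R := laxOf d.ell

/-- `L⁻¹`. -/
def laxInv : PowerSeries R := laxInvOf d.ell

/-- `∑ uₙ W ^ n`. -/
def uSeries (W : PowerSeries R) : PowerSeries R :=
  (PowerSeries.X * PowerSeries.mk d.u).subst W

/-- `∑ vₙ W ^ n`. -/
def vSeries (W : PowerSeries R) : PowerSeries R :=
  (PowerSeries.X * PowerSeries.mk d.v).subst W

/-- `∑ hₙ W ^ (n + 1)`. -/
def hSeries (W : PowerSeries R) : PowerSeries R :=
  (PowerSeries.X ^ 2 * PowerSeries.mk d.h).subst W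

theorem constantCoeff_ell : PowerSeries.constantCoeff d.ell = 1 := by simp [ell]

theorem constantCoeff_laxInv : PowerSeries.constantCoeff d.laxInv = 0 :=
  constantCoeff_laxInvOf _

theorem constantCoeff_uSeries {W : PowerSeries R} (hW : PowerSeries.constantCoeff W = 0) :
    PowerSeries.constantCoeff (d.uSeries W) = 0 :=
  PowerSeries.constantCoeff_subst_eq_zero hW _ (by simp)

theorem constantCoeff_C_mul_uSeries (r : R) {W : PowerSeries R}
    (hW : PowerSeries.constantCoeff W = 0) :
    PowerSeries.constantCoeff (PowerSeries.C r * d.uSeries W) = 0 := by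
  rw [map_mul, d.constantCoeff_uSeries hW, mul_zero]

/-- This and the following `map_` lemmas express naturality in the coefficient ring. They reduce the
comparison of series over different rings to a comparison of `Symbols` after evaluation at a point.
-/
theorem map_ell : (d.map φ).ell = PowerSeries.map φ d.ell := by
  ext n
  simp [ell, map, PowerSeries.coeff_X_pow_mul', PowerSeries.coeff_one]

theorem map_invOfUnit {ℓ : PowerSeries R} (hℓ : PowerSeries.constantCoeff ℓ = 1) :
    PowerSeries.map φ (PowerSeries.invOfUnit ℓ 1) = PowerSeries.invOfUnit (PowerSeries.map φ ℓ) 1 := by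
  have h1 : ℓ * PowerSeries.invOfUnit ℓ 1 = 1 := PowerSeries.mul_invOfUnit _ _ (by simp [hℓ])
  have h2 : PowerSeries.map φ ℓ * PowerSeries.invOfUnit (PowerSeries.map φ ℓ) 1 = 1 :=
    PowerSeries.mul_invOfUnit _ _ (by
      rw [← PowerSeries.coeff_zero_eq_constantCoeff_apply, PowerSeries.coeff_map,
        PowerSeries.coeff_zero_eq_constantCoeff_apply, hℓ, map_one, Units.val_one])
  have h3 := congrArg (PowerSeries.map φ) h1
  rw [map_mul, map_one] at h3
  calc _ = PowerSeries.map φ (PowerSeries.invOfUnit ℓ 1) * (PowerSeries.map φ ℓ *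
        PowerSeries.invOfUnit (PowerSeries.map φ ℓ) 1) := by rw [h2, mul_one]
    _ = (PowerSeries.map φ ℓ * PowerSeries.map φ (PowerSeries.invOfUnit ℓ 1)) *
        PowerSeries.invOfUnit (PowerSeries.map φ ℓ) 1 := by ring
    _ = _ := by rw [h3, one_mul]

theorem map_laxInv : (d.map φ).laxInv = PowerSeries.map φ d.laxInv := by
  rw [laxInv, laxInv, laxInvOf, laxInvOf, map_mul, PowerSeries.map_X, map_ell,
    map_invOfUnit φ d.constantCoeff_ell]

theorem map_lax : (d.map φ).lax = mapLaurent φ d.lax := by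
  rw [lax, lax, laxOf, laxOf, map_mul, mapLaurent_single, mapLaurent_ofPowerSeries, map_one φ, map_ell]

theorem map_subst_of_constantCoeff {W : PowerSeries R} (hW : PowerSeries.constantCoeff W = 0)
    (P : PowerSeries R) :
    PowerSeries.map φ (P.subst W) = (PowerSeries.map φ P).subst (PowerSeries.map φ W) :=
  PowerSeries.map_subst (PowerSeries.HasSubst.of_constantCoeff_zero' hW) P

theorem map_mk (a : ℕ → R) : PowerSeries.map φ (PowerSeries.mk a) = PowerSeries.mk (φ ∘ a) := by
  ext n; simp

theorem map_uSeries {W : PowerSeries R} (hW : PowerSeries.constantCoeff W = 0) :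
    (d.map φ).uSeries (PowerSeries.map φ W) = PowerSeries.map φ (d.uSeries W) := by
  rw [uSeries, uSeries, map_subst_of_constantCoeff φ hW, map_mul, PowerSeries.map_X, map_mk]
  rfl

theorem map_vSeries {W : PowerSeries R} (hW : PowerSeries.constantCoeff W = 0) :
    (d.map φ).vSeries (PowerSeries.map φ W) = PowerSeries.map φ (d.vSeries W) := by
  rw [vSeries, vSeries, map_subst_of_constantCoeff φ hW, map_mul, PowerSeries.map_X, map_mk]
  rfl

theorem map_hSeries {W : PowerSeries R} (hW : PowerSeries.constantCoeff W = 0) :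
    (d.map φ).hSeries (PowerSeries.map φ W) = PowerSeries.map φ (d.hSeries W) := by
  rw [hSeries, hSeries, map_subst_of_constantCoeff φ hW, map_mul, map_pow, PowerSeries.map_X, map_mk]
  rfl

variable [Algebra ℚ R] [Algebra ℚ R'] (S : Finset (ℕ × ℤ))

/-- `exp (iαU)`. -/
def expSeries (α : ℤ) (W : PowerSeries R) : LaurentSeries R :=
  HahnSeries.C (d.e α) * HahnSeries.ofPowerSeries ℤ R
    ((PowerSeries.exp R).subst (PowerSeries.C (d.c α) * d.uSeries W))

/-- `M`. -/
def mSeries (Λ : LaurentSeries R) (W : PowerSeries R) : LaurentSeries R :=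
  ∑ i ∈ S, HahnSeries.C ((i.1 : R) * d.τ i) * Λ ^ (i.1 - 1) * d.expSeries i.2 W +
    HahnSeries.C d.x + HahnSeries.ofPowerSeries ℤ R (d.hSeries W)

/-- `V - θ₂`. -/
def vPeriodic (Λ : LaurentSeries R) (W : PowerSeries R) : LaurentSeries R :=
  ∑ i ∈ S, HahnSeries.C (d.c i.2 * d.τ i) * Λ ^ i.1 * d.expSeries i.2 W +
    HahnSeries.ofPowerSeries ℤ R (d.vSeries W)

theorem map_expSeries (α : ℤ) {W : PowerSeries R} (hW : PowerSeries.constantCoeff W = 0) :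
    (d.map φ).expSeries α (PowerSeries.map φ W) = mapLaurent φ (d.expSeries α W) := by
  rw [expSeries, expSeries, map_mul, mapLaurent_C, mapLaurent_ofPowerSeries,
    map_subst_of_constantCoeff φ (d.constantCoeff_C_mul_uSeries _ hW), PowerSeries.map_exp, map_mul,
    PowerSeries.map_C, map_uSeries d φ hW]
  rfl

theorem map_mSeries {Λ : LaurentSeries R} {W : PowerSeries R}
    (hW : PowerSeries.constantCoeff W = 0) :
    (d.map φ).mSeries S (mapLaurent φ Λ) (PowerSeries.map φ W) =
      mapLaurent φ (d.mSeries S Λ W) := by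
  simp only [mSeries, map_add, map_sum, map_mul, map_pow, mapLaurent_C, mapLaurent_ofPowerSeries,
    ← map_expSeries d φ _ hW, ← map_hSeries d φ hW, map_natCast]
  rfl

theorem map_vPeriodic {Λ : LaurentSeries R} {W : PowerSeries R}
    (hW : PowerSeries.constantCoeff W = 0) :
    (d.map φ).vPeriodic S (mapLaurent φ Λ) (PowerSeries.map φ W) =
      mapLaurent φ (d.vPeriodic S Λ W) := by
  simp only [vPeriodic, map_add, map_sum, map_mul, map_pow, mapLaurent_C, mapLaurent_ofPowerSeries,
    ← map_expSeries d φ _ hW, ← map_vSeries d φ hW]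
  rfl

theorem expSeries_zero (hc : d.c 0 = 0) (he : d.e 0 = 1) (W : PowerSeries R) :
    d.expSeries 0 W = 1 := by
  have h : (PowerSeries.exp R).subst (0 : PowerSeries R) = (1 : PowerSeries R) := by
    rw [PowerSeries.subst_zero_eq_C_constantCoeff, PowerSeries.constantCoeff_exp]
    exact map_one PowerSeries.C
  rw [expSeries, hc, he, map_zero, zero_mul, h, map_one, map_one, mul_one]

/-- Passing from `λ` to `L` changes only the variable, not the coefficients `c`, `e`, `u`;
associativity of substitution carries this through the exponential. -/
theorem isComposition_expSeries (α : ℤ) :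
    IsComposition d.ell (d.expSeries α PowerSeries.X) (d.expSeries α d.laxInv) := by
  refine (IsComposition.C _).mul ?_
  have h := IsComposition.powerSeries (ℓ := d.ell)
    ((PowerSeries.exp R).subst (PowerSeries.C (d.c α) * d.uSeries PowerSeries.X))
  have hs := hasSubst_laxInvOf d.ell
  have hx : d.uSeries PowerSeries.X = PowerSeries.X * PowerSeries.mk d.u := PowerSeries.X_subst _
  have e : (PowerSeries.C (d.c α) * d.uSeries PowerSeries.X).subst (laxInvOf d.ell) =
      PowerSeries.C (d.c α) * d.uSeries d.laxInv := by
    rw [PowerSeries.subst_mul hs, PowerSeries.subst_C, hx]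
    rfl
  rw [PowerSeries.subst_comp_subst_apply (PowerSeries.HasSubst.of_constantCoeff_zero'
    (d.constantCoeff_C_mul_uSeries _ (by simp))) hs, e] at h
  exact h

theorem isComposition_mSeries :
    IsComposition d.ell (d.mSeries S (HahnSeries.single (-1 : ℤ) (1 : R)) PowerSeries.X)
      (d.mSeries S d.lax d.laxInv) := by
  refine .add d.constantCoeff_ell (.add d.constantCoeff_ell
    (.sum d.constantCoeff_ell S fun i _ => ?_) (.C _)) ?_
  · exact ((IsComposition.C _).mul (.var_pow _)).mul (d.isComposition_expSeries i.2)
  · have h := IsComposition.powerSeries (ℓ := d.ell) (d.hSeries PowerSeries.X)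
    have hx : d.hSeries PowerSeries.X = PowerSeries.X ^ 2 * PowerSeries.mk d.h :=
      PowerSeries.X_subst _
    have e : (d.hSeries PowerSeries.X).subst (laxInvOf d.ell) = d.hSeries d.laxInv := by
      rw [hx]; rfl
    rwa [e] at h

/-- The derivative of `exp (iαU)`, where `κ` is the derivative of `θ₁`. -/
theorem der_expSeries {D : Der (LaurentSeries R)} (hD : IsLocalDer D) {α : ℤ}
    {κ : LaurentSeries R} (hc : D (HahnSeries.C (d.c α)) = 0)
    (he : D (HahnSeries.C (d.e α)) = HahnSeries.C (d.c α) * HahnSeries.C (d.e α) * κ)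
    {W : PowerSeries R} (hW : PowerSeries.constantCoeff W = 0) :
    D (d.expSeries α W) = HahnSeries.C (d.c α) * d.expSeries α W *
      (κ + D (HahnSeries.ofPowerSeries ℤ R (d.uSeries W))) := by
  rw [expSeries, Der.leibniz, he, der_exp_subst hD (d.constantCoeff_C_mul_uSeries _ hW), map_mul,
    HahnSeries.ofPowerSeries_C, Der.leibniz D (HahnSeries.C _), hc]
  ring

end Symbols

/-! ### Laurent series over the algebra of regular functions -/

section PhaseDerivations

variable {S : Finset (ℕ × ℤ)} {W : TopologicalSpace.Opens (Params S)}

theorem regularDer_algebraMap (v : Phase S) (c : ℂ) :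
    regularDer v (algebraMap ℂ (regularAlgebra W) c) = 0 := by
  ext p
  change fderiv ℝ (extend fun _ => c) p v = 0
  rw [(extend_restrict_eventuallyEq (F := fun _ => c) p.2).fderiv_eq]
  simp

/-- The derivations `∂/∂k, ∂/∂x, ∂/∂θ₁, ∂/∂θ₂`. -/
def phaseDer : Fin 4 → Der (LaurentSeries (regularAlgebra W)) :=
  ![kDerivation, coeffDerivation (regularDer ((0, 1), 0)),
    coeffDerivation (regularDer (0, 1, 0)), coeffDerivation (regularDer (0, 0, 1))]

/-- The derivation along a direction of `(t, x)`-space. -/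
def flowDer (v : Params S) : Der (LaurentSeries (regularAlgebra W)) :=
  coeffDerivation (regularDer (v, 0))

theorem phaseDer_comm (i j : Fin 4) (A : LaurentSeries (regularAlgebra W)) :
    phaseDer i (phaseDer j A) = phaseDer j (phaseDer i A) := by
  have h : ∀ v w, coeffDerivation (regularDer v) (coeffDerivation (regularDer w) A) =
      coeffDerivation (regularDer w) (coeffDerivation (regularDer v) A) := fun v w =>
    coeffDerivation_comm (regularDer_comm v w) A
  fin_cases i <;> fin_cases j <;>
    first | rfl | exact kDerivation_coeffDerivation _ _ |
      exact (kDerivation_coeffDerivation _ _).symm | exact h _ _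

theorem flowDer_phaseDer_zero (v : Params S) (A : LaurentSeries (regularAlgebra W)) :
    flowDer v (phaseDer 0 A) = phaseDer 0 (flowDer v A) :=
  (kDerivation_coeffDerivation _ _).symm

theorem isLocalDer_phaseDer (i : Fin 4) : IsLocalDer (phaseDer (W := W) i) := by
  fin_cases i
  · exact isLocalDer_kDerivation
  all_goals exact isLocalDer_coeffDerivation _

theorem phaseDer_C_algebraMap (i : Fin 4) (c : ℂ) :
    phaseDer i (HahnSeries.C (algebraMap ℂ (regularAlgebra W) c)) = 0 := by
  fin_cases i
  · exact kDerivation_C _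
  all_goals exact (coeffDerivation_C _ _).trans (by rw [regularDer_algebraMap, map_zero])

theorem flowDer_C_algebraMap (v : Params S) (c : ℂ) :
    flowDer v (HahnSeries.C (algebraMap ℂ (regularAlgebra W) c)) = 0 :=
  (coeffDerivation_C _ _).trans (by rw [regularDer_algebraMap, map_zero])

/-- The integral over the torus of the residue. -/
def residueMean (w : Params S) : LaurentSeries (regularAlgebra W) →+ ℂ where
  toFun A := torusMean w (A.coeff 1)
  map_zero' := by simp
  map_add' A B := by simp

theorem residueMean_phaseDer_zero (w : Params S) (A : LaurentSeries (regularAlgebra W)) :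
    residueMean w (phaseDer 0 A) = 0 := by
  change torusMean w ((kDerivation A).coeff 1) = 0
  rw [kDerivation_coeff_one, map_zero]

theorem residueMean_phaseDer_two {w : Params S} (hw : w ∈ W)
    (A : LaurentSeries (regularAlgebra W)) : residueMean w (phaseDer 2 A) = 0 :=
  torusMean_regularDer_left hw _

theorem residueMean_phaseDer_three {w : Params S} (hw : w ∈ W)
    (A : LaurentSeries (regularAlgebra W)) : residueMean w (phaseDer 3 A) = 0 :=
  torusMean_regularDer_right hw _

theorem hasFDerivAt_residueMean {w : Params S} (hw : w ∈ W) (A : LaurentSeries (regularAlgebra W)) :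
    ∃ A' : Params S →L[ℂ] ℂ, HasFDerivAt (fun w => residueMean w A) A' w ∧
      ∀ v, A' v = residueMean w (flowDer v A) :=
  hasFDerivAt_torusMean hw _

/-- The differential of `f + A`, where `f` is a function with constant partial derivatives `κ`. -/
def shiftedDifferential (κ : Fin 4 → ℂ) (A : LaurentSeries (regularAlgebra W)) :
    Fin 4 → LaurentSeries (regularAlgebra W) :=
  fun i => HahnSeries.C (algebraMap ℂ (regularAlgebra W) (κ i)) + phaseDer i A

theorem shiftedDifferential_zero (A : LaurentSeries (regularAlgebra W)) :
    shiftedDifferential 0 A = differential phaseDer A := by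
  ext i : 1
  simp only [shiftedDifferential, Pi.zero_apply, map_zero, zero_add, differential]

theorem isClosedForm_shiftedDifferential (κ : Fin 4 → ℂ) (A : LaurentSeries (regularAlgebra W)) :
    IsClosedForm phaseDer (shiftedDifferential κ A) := by
  constructor <;>
    simp only [shiftedDifferential, map_add, phaseDer_C_algebraMap, zero_add] <;>
    exact phaseDer_comm _ _ _

end PhaseDerivations

/-! ### Comparison with series of functions of `(x, θ)` -/

section Represents

theorem embed_fst_apply (S : Finset (ℕ × ℤ)) (w : Params S) (i : ℕ × ℤ) :
    (embed S w).1 i = if h : i ∈ S then w.1 ⟨i, h⟩ else 0 := by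
  classical
  simp only [embed, Finsupp.finsetSum_apply, Finsupp.single_apply]
  split_ifs with h
  · rw [Finset.sum_eq_single ⟨i, h⟩]
    · simp
    · rintro ⟨b, hb⟩ - hne
      rw [if_neg]
      rintro rfl
      exact hne rfl
    · simp
  · refine Finset.sum_eq_zero fun b _ => if_neg ?_
    rintro rfl
    exact h b.2

theorem support_embed_fst (S : Finset (ℕ × ℤ)) (w : Params S) : (embed S w).1.support ⊆ S := by
  intro i hi
  by_contra h
  rw [Finsupp.mem_support_iff, embed_fst_apply, dif_neg h] at hi
  exact hi rfl

variable {S : Finset (ℕ × ℤ)} {W : TopologicalSpace.Opens (Params S)}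

/-- Evaluation of regular functions at a point. -/
def evalRegular (p : phaseDomain W) : regularAlgebra W →+* ℂ :=
  (Pi.evalRingHom (fun _ => ℂ) p).comp (regularAlgebra W).val.toRingHom

theorem evalRegular_apply (p : phaseDomain W) (f : regularAlgebra W) :
    evalRegular p f = extend f.1 p := (extend_coe _ _).symm

/-- Evaluation of functions of `(x, θ)` at a point. -/
def evalCoef (y : ℂ × ℝ × ℝ) : Coef →+* ℂ := Pi.evalRingHom (fun _ => ℂ) y

/-- The series `A` with regular coefficients agrees with the family of series `A'` over `W`. -/
def Represents (A : LaurentSeries (regularAlgebra W)) (A' : Times → Ser) : Prop :=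
  ∀ p : phaseDomain W, mapLaurent (evalRegular p) A =
    mapLaurent (evalCoef (p.1.1.2, p.1.2)) (A' (embed S p.1.1).1)

namespace Represents

variable {A B : LaurentSeries (regularAlgebra W)} {A' B' : Times → Ser}

theorem extend_coeff (h : Represents A A') {p : Phase S} (hp : p ∈ phaseDomain W) (j : ℤ) :
    extend (A.coeff j).1 p = (A' (embed S p.1).1).coeff j (p.1.2, p.2) := by
  have h1 := congrArg (fun C => HahnSeries.coeff C j) (h ⟨p, hp⟩)
  simp only [mapLaurent_coeff] at h1
  rw [evalRegular_apply] at h1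
  exact h1

theorem of_extend_coeff (h : ∀ p ∈ phaseDomain W, ∀ j : ℤ,
    extend (A.coeff j).1 p = (A' (embed S p.1).1).coeff j (p.1.2, p.2)) : Represents A A' := by
  intro p
  ext j
  rw [mapLaurent_coeff, mapLaurent_coeff, evalRegular_apply]
  exact h p p.2 j

theorem mul (hA : Represents A A') (hB : Represents B B') :
    Represents (A * B) (fun t => A' t * B' t) := fun p => by
  rw [map_mul, map_mul, hA p, hB p]

theorem add (hA : Represents A A') (hB : Represents B B') :
    Represents (A + B) (fun t => A' t + B' t) := fun p => by
  rw [map_add, map_add, hA p, hB p]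

theorem sub (hA : Represents A A') (hB : Represents B B') :
    Represents (A - B) (fun t => A' t - B' t) := fun p => by
  rw [map_sub, map_sub, hA p, hB p]

theorem pow (hA : Represents A A') (n : ℕ) : Represents (A ^ n) (fun t => A' t ^ n) := fun p => by
  rw [map_pow, map_pow, hA p]

theorem nonnegPart (hA : Represents A A') :
    Represents (HahnSeries.truncLT (1 : ℤ) A) (fun t => nonnegPart (A' t)) := by
  refine of_extend_coeff fun p hp j => ?_
  rcases lt_or_ge j 1 with h | h
  · rw [HahnSeries.coeff_truncLT_of_lt h, hA.extend_coeff hp, Toroidal.nonnegPart,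
      HahnSeries.coeff_truncLT_of_lt h]
  · rw [HahnSeries.coeff_truncLT_of_le h, Toroidal.nonnegPart, HahnSeries.coeff_truncLT_of_le h,
      extend_of_mem _ hp]
    rfl

/-- Regular functions live on the domain only, so pointwise coefficient identities over it become
equalities in the ring of Laurent series, where algebra applies. -/
theorem eq_of_eq (hA : Represents A A') (hB : Represents B B')
    (h : ∀ p ∈ phaseDomain W, ∀ j : ℤ, (A' (embed S p.1).1).coeff j (p.1.2, p.2) =
      (B' (embed S p.1).1).coeff j (p.1.2, p.2)) : A = B := by
  ext j p
  rw [← extend_coe (A.coeff j).1, ← extend_coe (B.coeff j).1, hA.extend_coeff p.2,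
    hB.extend_coeff p.2, h p p.2 j]

theorem hasDerivAt_params (hA : Represents A A') {p : Phase S} (hp : p ∈ phaseDomain W) (j : ℤ)
    (v : Params S) : HasDerivAt (fun s : ℂ => (A' (embed S (p.1 + s • v)).1).coeff j
      (p.1.2 + s • v.2, p.2)) (extend ((flowDer v A).coeff j).1 p) 0 := by
  obtain ⟨D, hD, hDv⟩ := hasFDerivAt_extend_params (A.coeff j) (w := p.1) hp p.2
  have h1 : HasLineDerivAt ℂ (fun w => extend (A.coeff j).1 (w, p.2)) (D v) p.1 v :=
    hD.hasLineDerivAt v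
  rw [hDv] at h1
  refine HasDerivAt.congr_of_eventuallyEq h1 ?_
  have hc : ContinuousAt (fun s : ℂ => p.1 + s • v) 0 := by fun_prop
  have hmem : ∀ᶠ s : ℂ in nhds 0, p.1 + s • v ∈ W :=
    hc (W.isOpen.mem_nhds (by simp only [zero_smul, add_zero]; exact hp))
  filter_upwards [hmem] with s hs
  rw [hA.extend_coeff (p := (p.1 + s • v, p.2)) hs]
  rfl

theorem hasDerivAt_x (hA : Represents A A') {p : Phase S} (hp : p ∈ phaseDomain W) (j : ℤ) :
    HasDerivAt (fun y : ℂ => (A' (embed S p.1).1).coeff j (y, p.2))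
      (extend ((phaseDer 1 A).coeff j).1 p) p.1.2 := by
  have h := hA.hasDerivAt_params hp j (0, 1)
  have h0 : ∀ s : ℂ, (embed S (p.1 + s • ((0, 1) : Params S))).1 = (embed S p.1).1 := fun s => by
    simp [embed]
  simp only [h0, smul_eq_mul, mul_one] at h
  have h2 := HasDerivAt.comp_sub_const (x := p.1.2) (a := p.1.2)
    (f := fun s : ℂ => (A' (embed S p.1).1).coeff j (p.1.2 + s, p.2))
    (f' := extend ((phaseDer 1 A).coeff j).1 p) (by rw [sub_self]; exact h)
  simpa using h2

theorem hasDerivAt_θ₁ (hA : Represents A A') {p : Phase S} (hp : p ∈ phaseDomain W) (j : ℤ) :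
    HasDerivAt (fun s : ℝ => (A' (embed S p.1).1).coeff j (p.1.2, s, p.2.2))
      (extend ((phaseDer 2 A).coeff j).1 p) p.2.1 := by
  have h := hasDerivAt_extend_line (A.coeff j) hp (0, 1, 0) (γ := fun s => (p.1, s, p.2.2))
    ((hasDerivAt_const p.2.1 _).prodMk ((hasDerivAt_id _).prodMk (hasDerivAt_const _ _))) rfl
  have e : ∀ s, extend (A.coeff j).1 (p.1, s, p.2.2) =
      (A' (embed S p.1).1).coeff j (p.1.2, s, p.2.2) := fun s =>
    hA.extend_coeff (p := (p.1, s, p.2.2)) hp j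
  simp only [e] at h
  exact h

theorem hasDerivAt_θ₂ (hA : Represents A A') {p : Phase S} (hp : p ∈ phaseDomain W) (j : ℤ) :
    HasDerivAt (fun s : ℝ => (A' (embed S p.1).1).coeff j (p.1.2, p.2.1, s))
      (extend ((phaseDer 3 A).coeff j).1 p) p.2.2 := by
  have h := hasDerivAt_extend_line (A.coeff j) hp (0, 0, 1) (γ := fun s => (p.1, p.2.1, s))
    ((hasDerivAt_const p.2.2 _).prodMk ((hasDerivAt_const _ _).prodMk (hasDerivAt_id _))) rfl
  have e : ∀ s, extend (A.coeff j).1 (p.1, p.2.1, s) =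
      (A' (embed S p.1).1).coeff j (p.1.2, p.2.1, s) := fun s =>
    hA.extend_coeff (p := (p.1, p.2.1, s)) hp j
  simp only [e] at h
  exact h

end Represents

theorem represents_one : Represents (1 : LaurentSeries (regularAlgebra W)) fun _ => 1 := fun p => by
  rw [map_one, map_one]

theorem represents_zero : Represents (0 : LaurentSeries (regularAlgebra W)) fun _ => 0 := fun p => by
  rw [map_zero, map_zero]

/-- The operators `∂/∂k, ∂/∂x, ∂/∂θ₁, ∂/∂θ₂` on series of functions of `(x, θ)`. -/
def serDer : Fin 4 → Ser → Ser := ![dk, dx, dθ₁, dθ₂]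

/-- The `1`-form `a` agrees with the differential of `A'` over `W`. -/
def RepresentsDifferential (a : Fin 4 → LaurentSeries (regularAlgebra W)) (A' : Times → Ser) :
    Prop := ∀ i, Represents (a i) fun t => serDer i (A' t)

theorem RepresentsDifferential.poisson {a b : Fin 4 → LaurentSeries (regularAlgebra W)}
    {A' B' : Times → Ser} (ha : RepresentsDifferential a A') (hb : RepresentsDifferential b B') :
    Represents (poisson a b) fun t => bracket (A' t) (B' t) :=
  ((((ha 0).mul (hb 1)).sub ((ha 1).mul (hb 0))).add ((ha 2).mul (hb 3))).sub ((ha 3).mul (hb 2))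

theorem dk_coeff (A : Ser) (j : ℤ) : (dk A).coeff j = (1 - j) * A.coeff (j - 1) := by
  rw [dk, HahnSeries.coeff_neg, HahnSeries.coeff_single_mul, one_mul, LaurentSeries.derivative_apply,
    LaurentSeries.hasseDeriv_coeff]
  have : j - 2 + ((1 : ℕ) : ℤ) = j - 1 := by push_cast; ring
  rw [this, Ring.choose_one_right]
  simp [sub_mul]

/-- The extra function `f` will be `θ₁` or `θ₂`, the nonperiodic part of `U` or `V`. It is not in
the algebra, but its partial derivatives are constants and are. -/
theorem Represents.differential_add {A : LaurentSeries (regularAlgebra W)} {A' : Times → Ser}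
    (hA : Represents A A') {f : Coef} {κ : Fin 4 → ℂ} (h0 : κ 0 = 0)
    (h1 : ∀ x θ, HasDerivAt (fun y => f (y, θ)) (κ 1) x)
    (h2 : ∀ x a b, HasDerivAt (fun s => f (x, s, b)) (κ 2) a)
    (h3 : ∀ x a b, HasDerivAt (fun s => f (x, a, s)) (κ 3) b) :
    RepresentsDifferential (shiftedDifferential κ A) (fun t => const f + A' t) := by
  have hC : ∀ (c : ℂ) (j : ℤ) (p : Phase S), p ∈ phaseDomain W →
      extend ((HahnSeries.C (algebraMap ℂ (regularAlgebra W) c) :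
        LaurentSeries (regularAlgebra W)).coeff j).1 p = if j = 0 then c else 0 := by
    intro c j p hp
    rw [HahnSeries.C_apply, HahnSeries.coeff_single, extend_of_mem _ hp]
    split_ifs <;> rfl
  have hf : ∀ (j : ℤ) (y : ℂ × ℝ × ℝ), (const f).coeff j y = if j = 0 then f y else 0 := by
    intro j y
    rw [const, HahnSeries.C_apply, HahnSeries.coeff_single]
    split_ifs <;> rfl
  have hif : ∀ {𝕜 : Type} [NontriviallyNormedField 𝕜] [NormedSpace 𝕜 ℂ] (j : ℤ) (φ : 𝕜 → ℂ) (c : ℂ)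
      (s : 𝕜), HasDerivAt φ c s →
      HasDerivAt (fun s => if j = 0 then φ s else 0) (if j = 0 then c else 0) s := by
    intro 𝕜 _ _ j φ c s h
    split_ifs
    · exact h
    · exact hasDerivAt_const _ _
  intro i
  refine Represents.of_extend_coeff fun p hp j => ?_
  rw [shiftedDifferential, HahnSeries.coeff_add, Subalgebra.coe_add, extend_add, Pi.add_apply, hC _ _ _ hp]
  fin_cases i
  · change (if j = 0 then κ 0 else 0) + extend ((kDerivation A).coeff j).1 p =
      (dk (const f + A' (embed S p.1).1)).coeff j (p.1.2, p.2)
    rw [h0, ite_self, zero_add, kDerivation_coeff, dk_coeff]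
    have e : extend ((1 - (j : regularAlgebra W)) * A.coeff (j - 1)).1 p =
        (1 - (j : ℂ)) * extend (A.coeff (j - 1)).1 p := by
      rw [Subalgebra.coe_mul, extend_mul, Pi.mul_apply, extend_of_mem (1 - (j : regularAlgebra W)).1 hp]
      congr 1
    rw [e, hA.extend_coeff hp, HahnSeries.coeff_add, Pi.mul_apply, Pi.add_apply, hf]
    -- The constant term `f` could enter the `k`-derivative only at `j = 1`, where the factor `1 -
    -- j` is zero.
    rcases eq_or_ne j 1 with rfl | hj
    · simp
    · rw [if_neg (by omega)]
      simp
  · exact (((hif j _ _ _ (h1 p.1.2 p.2)).add (hA.hasDerivAt_x hp j)).congr_of_eventuallyEq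
      (Filter.Eventually.of_forall fun s => by
        simp only [HahnSeries.coeff_add, Pi.add_apply, hf])).deriv.symm
  · exact (((hif j _ _ _ (h2 p.1.2 p.2.1 p.2.2)).add (hA.hasDerivAt_θ₁ hp j)).congr_of_eventuallyEq
      (Filter.Eventually.of_forall fun s => by
        simp only [HahnSeries.coeff_add, Pi.add_apply, hf])).deriv.symm
  · exact (((hif j _ _ _ (h3 p.1.2 p.2.1 p.2.2)).add (hA.hasDerivAt_θ₂ hp j)).congr_of_eventuallyEq
      (Filter.Eventually.of_forall fun s => by
        simp only [HahnSeries.coeff_add, Pi.add_apply, hf])).deriv.symm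

theorem Represents.differential {A : LaurentSeries (regularAlgebra W)} {A' : Times → Ser}
    (hA : Represents A A') : RepresentsDifferential (differential phaseDer A) A' := by
  have h := hA.differential_add (f := 0) (κ := 0) rfl (fun _ _ => hasDerivAt_const _ _)
    (fun _ _ _ => hasDerivAt_const _ _) (fun _ _ _ => hasDerivAt_const _ _)
  rw [shiftedDifferential_zero] at h
  simpa [const] using h

end Represents

/-! ### The fields as series with regular coefficients -/

section Fields

/-- The coefficients of the fields at the times `t`, as functions of `(x, θ)`. -/
def Fields.symbols (Φ : Fields) (t : Times) : Symbols Coef where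
  τ i := fun _ => t i
  c α := fun _ => Complex.I * α
  e α := fun p => Complex.exp (Complex.I * α * p.2.1)
  x := fun p => p.1
  g n := Φ.g n t
  h n := Φ.h n t
  u n := Φ.u n t
  v n := Φ.v n t

/-- The support of `t` varies with the point. Summing over a fixed `S` containing it adds only zero
terms and gives one formula on the whole coordinate subspace. -/
theorem Fields.Mof_eq (Φ : Fields) {t : Times} {S : Finset (ℕ × ℤ)} (hS : t.support ⊆ S) (Λ : Ser)
    (P : PowerSeries Coef) : Φ.Mof t Λ P = (Φ.symbols t).mSeries S Λ P := by
  rw [Fields.Mof, Finsupp.sum_of_support_subset t hS]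
  · rfl
  · intro i _
    have : (fun _ => (i.1 : ℂ) * 0 : Coef) = 0 := by ext; simp
    rw [this]
    simp [const]

theorem Fields.Vof_eq (Φ : Fields) {t : Times} {S : Finset (ℕ × ℤ)} (hS : t.support ⊆ S) (Λ : Ser)
    (P : PowerSeries Coef) :
    Φ.Vof t Λ P = const (fun p => (p.2.2 : ℂ)) + (Φ.symbols t).vPeriodic S Λ P := by
  rw [Fields.Vof, Finsupp.sum_of_support_subset t hS]
  · rw [add_comm _ (const _), add_assoc]
    rfl
  · intro i _
    have : (fun _ => Complex.I * i.2 * 0 : Coef) = 0 := by ext; simp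
    rw [this]
    simp [const]

theorem Fields.expUof_zero (Φ : Fields) (t : Times) (P : PowerSeries Coef) : Φ.expUof t 0 P = 1 :=
  (Φ.symbols t).expSeries_zero (by ext; simp [Fields.symbols]) (by ext; simp [Fields.symbols]) P

variable {Ω : Set (Times × ℂ)} (hΩ : IsFinOpen Ω) (S : Finset (ℕ × ℤ))

/-- The trace of `Ω` on a coordinate subspace. -/
def paramOpens : TopologicalSpace.Opens (Params S) := ⟨embed S ⁻¹' Ω, hΩ S⟩

variable {S}

theorem isRegularFun_of_isRegular {f : Times → Coef} (h : IsRegular Ω f)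
    (hp : IsDoublyPeriodic Ω f) : IsRegularFun (W := paramOpens hΩ S)
      (fun p => f (embed S p.1.1).1 ((embed S p.1.1).2, p.1.2)) := by
  refine IsRegularFun.of_contDiffOn
    (F := fun p : Phase S => f (embed S p.1).1 ((embed S p.1).2, p.2)) (h S).1 (h S).2 ?_ ?_
  · rintro ⟨w, a, b⟩ hw
    simpa using (hp (embed S w).1 (embed S w).2 hw a b).1
  · rintro ⟨w, a, b⟩ hw
    simpa using (hp (embed S w).1 (embed S w).2 hw a b).2

theorem isRegularFun_params {W : TopologicalSpace.Opens (Params S)} (A : Params S →L[ℂ] ℂ) :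
    IsRegularFun (W := W) (fun p => A p.1.1) :=
  IsRegularFun.of_contDiffOn (F := fun p : Phase S => A p.1)
    ((A.restrictScalars ℝ).contDiff.comp contDiff_fst).contDiffOn
    (fun _ => A.differentiable.differentiableOn) (fun p _ => by simp) (fun p _ => by simp)

theorem isRegularFun_exp {W : TopologicalSpace.Opens (Params S)} (α : ℤ) :
    IsRegularFun (W := W) (fun p => Complex.exp (Complex.I * α * p.1.2.1)) := by
  refine IsRegularFun.of_contDiffOn
    (F := fun p : Phase S => Complex.exp (Complex.I * α * p.2.1)) ?_
    (fun θ => differentiableOn_const (Complex.exp (Complex.I * α * θ.1))) (fun p _ => ?_) (fun p _ => by simp)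
  · refine ContDiff.contDiffOn ?_
    exact (contDiff_const.mul (Complex.ofRealCLM.contDiff.comp (contDiff_fst.comp contDiff_snd))).cexp
  · rw [Complex.exp_eq_exp_iff_exists_int]
    -- A shift of `θ₁` by `2π` changes the exponent by `α` periods; integrality of `α` is what makes
    -- the exponential periodic.
    refine ⟨α, ?_⟩
    simp
    ring

variable {hΩ} {Φ : Fields} (hΦ : IsSolution Ω Φ) (S)

variable (hΩ) in
/-- The coefficients of the fields, as regular functions of `(t, x, θ)`. -/
def regularSymbols : Symbols (regularAlgebra (paramOpens hΩ S)) where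
  τ i := if h : i ∈ S then ⟨_, isRegularFun_params
    ((ContinuousLinearMap.proj (R := ℂ) ⟨i, h⟩).comp (ContinuousLinearMap.fst ℂ (S → ℂ) ℂ))⟩ else 0
  c α := algebraMap ℂ _ (Complex.I * α)
  e α := ⟨_, isRegularFun_exp α⟩
  x := ⟨_, isRegularFun_params (ContinuousLinearMap.snd ℂ (S → ℂ) ℂ)⟩
  g n := ⟨_, isRegularFun_of_isRegular hΩ (hΦ.regular_g n) (hΦ.periodic_g n)⟩
  h n := ⟨_, isRegularFun_of_isRegular hΩ (hΦ.regular_h n) (hΦ.periodic_h n)⟩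
  u n := ⟨_, isRegularFun_of_isRegular hΩ (hΦ.regular_u n) (hΦ.periodic_u n)⟩
  v n := ⟨_, isRegularFun_of_isRegular hΩ (hΦ.regular_v n) (hΦ.periodic_v n)⟩

/-- Both sets of coefficients have the same values at each point. By naturality the same then holds
for every series built from them, which is how the `represents_` lemmas are obtained. -/
theorem regularSymbols_map (p : phaseDomain (paramOpens hΩ S)) :
    (regularSymbols hΩ S hΦ).map (evalRegular p) =
      (Φ.symbols (embed S p.1.1).1).map (evalCoef (p.1.1.2, p.1.2)) := by
  refine Symbols.ext ?_ rfl rfl rfl rfl rfl rfl rfl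
  ext i
  change evalRegular p (dite _ _ _) = (embed S p.1.1).1 i
  rw [embed_fst_apply]
  split_ifs with h
  · rfl
  · rfl

/-- `L` with regular coefficients. -/
abbrev regularL : LaurentSeries (regularAlgebra (paramOpens hΩ S)) := (regularSymbols hΩ S hΦ).lax

/-- `e^{iαU}` with regular coefficients. -/
abbrev regularE (α : ℤ) : LaurentSeries (regularAlgebra (paramOpens hΩ S)) :=
  (regularSymbols hΩ S hΦ).expSeries α (regularSymbols hΩ S hΦ).laxInv

/-- `M` with regular coefficients. -/
abbrev regularM : LaurentSeries (regularAlgebra (paramOpens hΩ S)) :=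
  (regularSymbols hΩ S hΦ).mSeries S (regularSymbols hΩ S hΦ).lax (regularSymbols hΩ S hΦ).laxInv

/-- `U - θ₁` with regular coefficients. -/
abbrev regularU : LaurentSeries (regularAlgebra (paramOpens hΩ S)) :=
  HahnSeries.ofPowerSeries ℤ _ ((regularSymbols hΩ S hΦ).uSeries (regularSymbols hΩ S hΦ).laxInv)

/-- `V - θ₂` with regular coefficients. -/
abbrev regularV : LaurentSeries (regularAlgebra (paramOpens hΩ S)) :=
  (regularSymbols hΩ S hΦ).vPeriodic S (regularSymbols hΩ S hΦ).lax
    (regularSymbols hΩ S hΦ).laxInv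

/-- `Lⁿ e^{iαU}` with regular coefficients. -/
abbrev regularT (i : ℕ × ℤ) : LaurentSeries (regularAlgebra (paramOpens hΩ S)) :=
  regularL S hΦ ^ i.1 * regularE S hΦ i.2

/-- `B_{nα}` with regular coefficients. -/
abbrev regularB (i : ℕ × ℤ) : LaurentSeries (regularAlgebra (paramOpens hΩ S)) :=
  HahnSeries.truncLT (1 : ℤ) (regularT S hΦ i)

/-- `dU` with regular coefficients. -/
abbrev regularDU : Fin 4 → LaurentSeries (regularAlgebra (paramOpens hΩ S)) :=
  shiftedDifferential ![0, 0, 1, 0] (regularU S hΦ)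

/-- `dV` with regular coefficients. -/
abbrev regularDV : Fin 4 → LaurentSeries (regularAlgebra (paramOpens hΩ S)) :=
  shiftedDifferential ![0, 0, 0, 1] (regularV S hΦ)

theorem represents_L : Represents (regularL (hΩ := hΩ) S hΦ) Φ.L := fun p => by
  rw [← Symbols.map_lax, regularSymbols_map, Symbols.map_lax]
  rfl

theorem represents_E (α : ℤ) : Represents (regularE (hΩ := hΩ) S hΦ α) fun t => Φ.expU t α :=
  fun p => by
    rw [← Symbols.map_expSeries _ _ _ (Symbols.constantCoeff_laxInv _), ← Symbols.map_laxInv,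
      regularSymbols_map, Symbols.map_laxInv,
      Symbols.map_expSeries _ _ _ (Symbols.constantCoeff_laxInv _)]
    rfl

theorem represents_M : Represents (regularM (hΩ := hΩ) S hΦ) Φ.M := fun p => by
  rw [← Symbols.map_mSeries _ _ _ (Symbols.constantCoeff_laxInv _), ← Symbols.map_laxInv,
    ← Symbols.map_lax, regularSymbols_map, Symbols.map_laxInv, Symbols.map_lax,
    Symbols.map_mSeries _ _ _ (Symbols.constantCoeff_laxInv _), Fields.M,
    Fields.Mof_eq Φ (support_embed_fst S _)]
  rfl

theorem represents_U : Represents (regularU (hΩ := hΩ) S hΦ)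
    fun t => ofPS (Φ.uTail t (Φ.Linv t)) := fun p => by
  rw [mapLaurent_ofPowerSeries, ← Symbols.map_uSeries _ _ (Symbols.constantCoeff_laxInv _),
    ← Symbols.map_laxInv, regularSymbols_map, Symbols.map_laxInv,
    Symbols.map_uSeries _ _ (Symbols.constantCoeff_laxInv _), ← mapLaurent_ofPowerSeries]
  rfl

theorem represents_V : Represents (regularV (hΩ := hΩ) S hΦ)
    fun t => (Φ.symbols t).vPeriodic S (Φ.L t) (Φ.Linv t) := fun p => by
  rw [← Symbols.map_vPeriodic _ _ _ (Symbols.constantCoeff_laxInv _), ← Symbols.map_laxInv,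
    ← Symbols.map_lax, regularSymbols_map, Symbols.map_laxInv, Symbols.map_lax,
    Symbols.map_vPeriodic _ _ _ (Symbols.constantCoeff_laxInv _)]
  rfl

theorem represents_B (i : ℕ × ℤ) : Represents (regularB (hΩ := hΩ) S hΦ i) fun t => Φ.B t i :=
  (((represents_L S hΦ).pow i.1).mul (represents_E S hΦ i.2)).nonnegPart

theorem hasDerivAt_ofReal (a : ℝ) : HasDerivAt (fun s : ℝ => (s : ℂ)) 1 a := by
  have h := Complex.ofRealCLM.hasDerivAt (x := a)
  rw [Complex.ofRealCLM_apply, Complex.ofReal_one] at h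
  exact h

theorem representsDifferential_U : RepresentsDifferential (regularDU (hΩ := hΩ) S hΦ) Φ.U := by
  refine (represents_U S hΦ).differential_add rfl (fun x θ => ?_) (fun x a b => ?_)
    (fun x a b => ?_)
  · exact hasDerivAt_const x (θ.1 : ℂ)
  · exact hasDerivAt_ofReal a
  · exact hasDerivAt_const b (a : ℂ)

theorem representsDifferential_V : ∀ i, Represents (regularDV (hΩ := hΩ) S hΦ i)
    fun t => serDer i (const (fun p => (p.2.2 : ℂ)) +
      (Φ.symbols t).vPeriodic S (Φ.L t) (Φ.Linv t)) := by
  refine (represents_V S hΦ).differential_add rfl (fun x θ => ?_) (fun x a b => ?_)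
    (fun x a b => ?_)
  · exact hasDerivAt_const x (θ.2 : ℂ)
  · exact hasDerivAt_const a (b : ℂ)
  · exact hasDerivAt_ofReal b

theorem Fields.V_embed_eq (w : Params S) : Φ.V (embed S w).1 = const (fun p => (p.2.2 : ℂ)) +
    (Φ.symbols (embed S w).1).vPeriodic S (Φ.L (embed S w).1) (Φ.Linv (embed S w).1) :=
  Fields.Vof_eq Φ (support_embed_fst S w) _ _

theorem representsDifferential_V' : RepresentsDifferential (regularDV (hΩ := hΩ) S hΦ) Φ.V :=
  fun i p => by
    rw [representsDifferential_V S hΦ i p]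
    beta_reduce
    rw [Fields.V_embed_eq]

theorem poisson_LM : poisson (differential phaseDer (regularL (hΩ := hΩ) S hΦ))
    (differential phaseDer (regularM S hΦ)) = 1 :=
  ((represents_L S hΦ).differential.poisson (represents_M S hΦ).differential).eq_of_eq
    represents_one fun p hp j => hΦ.bracket_LM (embed S p.1).1 (embed S p.1).2 hp p.2 j

theorem poisson_UV : poisson (regularDU (hΩ := hΩ) S hΦ) (regularDV S hΦ) = 1 :=
  ((representsDifferential_U S hΦ).poisson (representsDifferential_V' S hΦ)).eq_of_eq
    represents_one fun p hp j => hΦ.bracket_UV (embed S p.1).1 (embed S p.1).2 hp p.2 j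

theorem poisson_LU : poisson (differential phaseDer (regularL (hΩ := hΩ) S hΦ))
    (regularDU S hΦ) = 0 :=
  ((represents_L S hΦ).differential.poisson (representsDifferential_U S hΦ)).eq_of_eq
    represents_zero fun p hp j => hΦ.bracket_LU (embed S p.1).1 (embed S p.1).2 hp p.2 j

theorem poisson_LV : poisson (differential phaseDer (regularL (hΩ := hΩ) S hΦ))
    (regularDV S hΦ) = 0 :=
  ((represents_L S hΦ).differential.poisson (representsDifferential_V' S hΦ)).eq_of_eq
    represents_zero fun p hp j => hΦ.bracket_LV (embed S p.1).1 (embed S p.1).2 hp p.2 j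

theorem poisson_MU : poisson (differential phaseDer (regularM (hΩ := hΩ) S hΦ))
    (regularDU S hΦ) = 0 :=
  ((represents_M S hΦ).differential.poisson (representsDifferential_U S hΦ)).eq_of_eq
    represents_zero fun p hp j => hΦ.bracket_MU (embed S p.1).1 (embed S p.1).2 hp p.2 j

theorem poisson_MV : poisson (differential phaseDer (regularM (hΩ := hΩ) S hΦ))
    (regularDV S hΦ) = 0 :=
  ((represents_M S hΦ).differential.poisson (representsDifferential_V' S hΦ)).eq_of_eq
    represents_zero fun p hp j => hΦ.bracket_MV (embed S p.1).1 (embed S p.1).2 hp p.2 j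

end Fields

/-- Since `L` has no `k⁰` term, its nonnegative part is `k`; this makes `x` act as the time
`t_{10}`. -/
theorem truncLT_laxOf {R : Type*} [CommRing R] (ℓ : PowerSeries R)
    (h0 : PowerSeries.coeff 0 ℓ = 1) (h1 : PowerSeries.coeff 1 ℓ = 0) :
    HahnSeries.truncLT (1 : ℤ) (laxOf ℓ) = HahnSeries.single (-1 : ℤ) 1 := by
  ext j
  rcases lt_or_ge j 1 with h | h
  · rw [HahnSeries.coeff_truncLT_of_lt h, laxOf, HahnSeries.coeff_single_mul, one_mul,
      ofPowerSeries_coeff, HahnSeries.coeff_single]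
    rcases lt_trichotomy j (-1) with hj | rfl | hj
    · rw [if_pos (by omega), if_neg hj.ne]
    · rw [if_neg (by omega), if_pos rfl]
      exact h0
    · obtain rfl : j = 0 := by omega
      rw [if_neg (by omega), if_neg (by omega)]
      exact h1
  · rw [HahnSeries.coeff_truncLT_of_le h, HahnSeries.coeff_single_of_ne (by omega)]

/-! ### Flow equations and equality of the cross derivatives -/

section Flows

variable {Ω : Set (Times × ℂ)} {hΩ : IsFinOpen Ω} (S : Finset (ℕ × ℤ)) {Φ : Fields}
  (hΦ : IsSolution Ω Φ)

theorem regularDer_e (v : Phase S) (α : ℤ) :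
    regularDer v ((regularSymbols hΩ S hΦ).e α) = (regularSymbols hΩ S hΦ).c α *
      (regularSymbols hΩ S hΦ).e α * algebraMap ℂ _ (v.2.1 : ℂ) := by
  ext p
  change fderiv ℝ (extend fun p => Complex.exp (Complex.I * α * p.1.2.1)) p v =
    Complex.I * α * Complex.exp (Complex.I * α * p.1.2.1) * v.2.1
  rw [(extend_restrict_eventuallyEq
    (F := fun p : Phase S => Complex.exp (Complex.I * α * p.2.1)) p.2).fderiv_eq]
  have h1 : HasFDerivAt (fun p : Phase S => ((p.2.1 : ℝ) : ℂ)) (Complex.ofRealCLM.comp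
      ((ContinuousLinearMap.fst ℝ ℝ ℝ).comp (ContinuousLinearMap.snd ℝ (Params S) (ℝ × ℝ)))) p.1 :=
    (Complex.ofRealCLM.comp ((ContinuousLinearMap.fst ℝ ℝ ℝ).comp
      (ContinuousLinearMap.snd ℝ (Params S) (ℝ × ℝ)))).hasFDerivAt
  have h2 := (h1.const_mul (Complex.I * α)).cexp
  rw [h2.fderiv]
  simp
  ring

theorem coeffDerivation_C_e (v : Phase S) (α : ℤ) {κ : ℂ} (hκ : (v.2.1 : ℂ) = κ) :
    coeffDerivation (regularDer v) (HahnSeries.C ((regularSymbols hΩ S hΦ).e α)) =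
      HahnSeries.C ((regularSymbols hΩ S hΦ).c α) * HahnSeries.C ((regularSymbols hΩ S hΦ).e α) *
        HahnSeries.C (algebraMap ℂ _ κ) := by
  rw [coeffDerivation_C, regularDer_e, map_mul, map_mul, hκ]

theorem phaseDer_C_e (i : Fin 4) (α : ℤ) :
    phaseDer i (HahnSeries.C ((regularSymbols hΩ S hΦ).e α)) =
      HahnSeries.C ((regularSymbols hΩ S hΦ).c α) * HahnSeries.C ((regularSymbols hΩ S hΦ).e α) *
        HahnSeries.C (algebraMap ℂ _ ((![0, 0, 1, 0] : Fin 4 → ℂ) i)) := by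
  match i with
  | 0 =>
    have h : (![0, 0, 1, 0] : Fin 4 → ℂ) 0 = 0 := rfl
    rw [h, map_zero, map_zero, mul_zero]
    exact kDerivation_C _
  | 1 => exact coeffDerivation_C_e S hΦ ((0, 1), 0) α Complex.ofReal_zero
  | 2 => exact coeffDerivation_C_e S hΦ (0, 1, 0) α Complex.ofReal_one
  | 3 => exact coeffDerivation_C_e S hΦ (0, 0, 1) α Complex.ofReal_zero

theorem regularSymbols_c (α : ℤ) :
    (regularSymbols hΩ S hΦ).c α = algebraMap ℂ _ (Complex.I * α) := rfl

theorem phaseDer_E (i : Fin 4) (α : ℤ) : phaseDer i (regularE (hΩ := hΩ) S hΦ α) =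
    HahnSeries.C ((regularSymbols hΩ S hΦ).c α) * regularE S hΦ α * regularDU S hΦ i := by
  have hc : phaseDer i (HahnSeries.C ((regularSymbols hΩ S hΦ).c α)) = 0 := by
    rw [regularSymbols_c]
    exact phaseDer_C_algebraMap i _
  exact Symbols.der_expSeries _ (isLocalDer_phaseDer i) hc
    (phaseDer_C_e S hΦ i α) (Symbols.constantCoeff_laxInv _)

theorem flowDer_E (v : Params S) (α : ℤ) : flowDer v (regularE (hΩ := hΩ) S hΦ α) =
    HahnSeries.C ((regularSymbols hΩ S hΦ).c α) * regularE S hΦ α * flowDer v (regularU S hΦ) := by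
  have he : flowDer v (HahnSeries.C ((regularSymbols hΩ S hΦ).e α)) =
      HahnSeries.C ((regularSymbols hΩ S hΦ).c α) * HahnSeries.C ((regularSymbols hΩ S hΦ).e α) *
        0 := by
    rw [flowDer, coeffDerivation_C, regularDer_e]
    simp
  have hc : flowDer v (HahnSeries.C ((regularSymbols hΩ S hΦ).c α)) = 0 := by
    rw [regularSymbols_c]
    exact flowDer_C_algebraMap v _
  have h := Symbols.der_expSeries _ (isLocalDer_coeffDerivation _) hc he
    (Symbols.constantCoeff_laxInv (regularSymbols hΩ S hΦ))
  rw [zero_add] at h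
  exact h

/-- The direction of the coordinate space that corresponds to a variable `t_{nα}` or `x`. -/
def paramDir : Option (ℕ × ℤ) → Params S
  | some i => (fun s => if (s : ℕ × ℤ) = i then 1 else 0, 0)
  | none => (0, 1)

/-- The index must lie in `S`: for a time outside `S` the vector `paramDir` is zero while
`direction` is not. -/
theorem embed_add_smul_paramDir {d : Option (ℕ × ℤ)} (hd : ∀ i, d = some i → i ∈ S) (w : Params S)
    (s : ℂ) : embed S (w + s • paramDir S d) = embed S w + s • direction d := by
  classical
  refine Prod.ext ?_ ?_
  · ext k
    change _ = (embed S w).1 k + s * (direction d).1 k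
    rw [embed_fst_apply, embed_fst_apply]
    cases d with
    | none => simp [paramDir, direction]
    | some i =>
      have hi := hd i rfl
      by_cases hk : k ∈ S
      · simp only [hk, dif_pos]
        by_cases hki : k = i
        · simp [paramDir, direction, hki]
        · simp [paramDir, direction, hki]
      · have hki : i ≠ k := fun h => hk (h ▸ hi)
        simp [hk, direction, hki]
  · cases d with
    | none => simp [paramDir, direction, embed]
    | some i => simp [paramDir, direction, embed]

variable {S}

/-- The Lax equation and the derivation of the regular algebra both compute the derivative of the
same coefficient along a time direction, so uniqueness of derivatives identifies them. The
time-independent `f` drops out; it accommodates `θ₁` in `U`. -/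
theorem flowDer_eq_of_lax {A P : LaurentSeries (regularAlgebra (paramOpens hΩ S))}
    {A' A'' : Times → Ser} {f : Coef} (hA : Represents A A') (hf : ∀ t, A'' t = const f + A' t)
    {i : ℕ × ℤ} (hi : i ∈ S) (hlax : LaxOver Ω Φ i A'')
    (hP : Represents P fun t => bracket (Φ.B t i) (A'' t)) :
    flowDer (paramDir S (some i)) A = P := by
  ext j p
  rw [← extend_coe ((flowDer _ A).coeff j).1, ← extend_coe (P.coeff j).1, hP.extend_coeff p.2]
  have h1 : HasDerivAt _ _ _ := hlax (embed S p.1.1).1 (embed S p.1.1).2 p.2 p.1.2 j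
  have h2 := (hA.hasDerivAt_params p.2 j (paramDir S (some i))).const_add
    ((const f).coeff j (p.1.1.2, p.1.2))
  refine HasDerivAt.unique h2 (h1.congr_of_eventuallyEq (Filter.Eventually.of_forall fun s => ?_))
  have h3 := congrArg Prod.fst (embed_add_smul_paramDir S (d := some i)
    (by rintro _ ⟨⟩; exact hi) p.1.1 s)
  have h4 : p.1.1.2 + s • (paramDir S (some i)).2 = p.1.1.2 := by simp [paramDir]
  simp only [h3, h4, hf, HahnSeries.coeff_add, Pi.add_apply]
  simp [direction]
  rfl

/-- The index `(n, α)` of the flow that corresponds to a variable `t_{nα}` or `x`. -/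
def flowIndex : Option (ℕ × ℤ) → ℕ × ℤ
  | some i => i
  | none => (1, 0)

theorem regularE_zero : regularE (hΩ := hΩ) S hΦ 0 = 1 := by
  refine Symbols.expSeries_zero _ ?_ ?_ _
  · simp [regularSymbols]
  · ext p
    simp [regularSymbols]

theorem regularB_one_zero :
    regularB (hΩ := hΩ) S hΦ (1, 0) = HahnSeries.single (-1 : ℤ) 1 := by
  rw [regularB, regularT, regularE_zero, mul_one, pow_one]
  exact truncLT_laxOf _ (by simp [Symbols.ell]) (by simp [Symbols.ell, PowerSeries.coeff_X_pow_mul'])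

/-- The flow equations. -/
theorem flowDer_eq {d : Option (ℕ × ℤ)} (hd : ∀ i, d = some i → i ∈ S) :
    flowDer (paramDir S d) (regularL (hΩ := hΩ) S hΦ) =
      poisson (differential phaseDer (regularB S hΦ (flowIndex d)))
        (differential phaseDer (regularL S hΦ)) ∧
    flowDer (paramDir S d) (regularM (hΩ := hΩ) S hΦ) =
      poisson (differential phaseDer (regularB S hΦ (flowIndex d)))
        (differential phaseDer (regularM S hΦ)) ∧
    flowDer (paramDir S d) (regularU (hΩ := hΩ) S hΦ) =
      poisson (differential phaseDer (regularB S hΦ (flowIndex d))) (regularDU S hΦ) := by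
  cases d with
  | none =>
    have h : ∀ a : Fin 4 → LaurentSeries (regularAlgebra (paramOpens hΩ S)),
        poisson (differential phaseDer (regularB S hΦ (flowIndex none))) a = a 1 := by
      intro a
      have h0 : phaseDer 0 (regularB (hΩ := hΩ) S hΦ (1, 0)) = 1 := by
        rw [regularB_one_zero]
        exact kDerivation_var
      have hi : ∀ v : Phase S, coeffDerivation (regularDer v)
          (regularB (hΩ := hΩ) S hΦ (1, 0)) = 0 := fun v => by
        rw [regularB_one_zero, coeffDerivation_single, Der.map_one, HahnSeries.single_eq_zero]
      have h1 : phaseDer 1 (regularB (hΩ := hΩ) S hΦ (1, 0)) = 0 := hi _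
      have h2 : phaseDer 2 (regularB (hΩ := hΩ) S hΦ (1, 0)) = 0 := hi _
      have h3 : phaseDer 3 (regularB (hΩ := hΩ) S hΦ (1, 0)) = 0 := hi _
      simp only [poisson, differential, flowIndex, h0, h1, h2, h3]
      ring
    rw [h, h, h]
    refine ⟨rfl, rfl, ?_⟩
    simp only [regularDU, shiftedDifferential]
    simp
    rfl
  | some i =>
    have hB := (represents_B (hΩ := hΩ) S hΦ i).differential
    have h0 : ∀ A : Ser, A = const 0 + A := fun A => by simp [const]
    exact ⟨flowDer_eq_of_lax (represents_L S hΦ) (fun t => h0 _) (hd i rfl) (hΦ.lax_L i)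
        (hB.poisson (represents_L S hΦ).differential),
      flowDer_eq_of_lax (represents_M S hΦ) (fun t => h0 _) (hd i rfl) (hΦ.lax_M i)
        (hB.poisson (represents_M S hΦ).differential),
      flowDer_eq_of_lax (represents_U S hΦ) (fun t => rfl) (hd i rfl) (hΦ.lax_U i)
        (hB.poisson (representsDifferential_U S hΦ))⟩

theorem Fields.rhs_none (Φ : Fields) : Φ.rhs none = Φ.rhs (some (1, 0)) := by
  ext q
  simp only [Fields.rhs, pow_one, Fields.expUspec, Fields.expUof_zero, mul_one]

theorem Fields.rhs_eq_flowIndex (Φ : Fields) (d : Option (ℕ × ℤ)) :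
    Φ.rhs d = Φ.rhs (some (flowIndex d)) := by
  cases d with
  | none => exact Φ.rhs_none
  | some i => rfl

/-- The right hand sides in terms of the residue with respect to `k`. -/
theorem rhs_embed_eq (i : ℕ × ℤ) (w : Params S) (hw : w ∈ paramOpens hΩ S) :
    Φ.rhs (some i) (embed S w) = residueMean w
      (regularT (hΩ := hΩ) S hΦ i * regularM S hΦ * phaseDer 0 (regularL S hΦ)) := by
  set σ := regularSymbols hΩ S hΦ with hσ
  have hcomp := ((IsComposition.var_pow i.1).mul (σ.isComposition_mSeries S)).mul
    (σ.isComposition_expSeries i.2)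
  -- This replaces the residue in `λ` of the integrand by the residue in `k` of its composition with
  -- `L`, times `∂ₖL`.
  have hres := hcomp.residue_eq σ.constantCoeff_ell
  have hrep : Represents (HahnSeries.single (-1 : ℤ) 1 ^ i.1 *
      σ.mSeries S (HahnSeries.single (-1 : ℤ) 1) PowerSeries.X * σ.expSeries i.2 PowerSeries.X)
      fun t => var ^ i.1 * Φ.Mspec t * Φ.expUspec t i.2 := by
    intro p
    have hX : PowerSeries.constantCoeff (PowerSeries.X :
      PowerSeries (regularAlgebra (paramOpens hΩ S))) = 0 := by simp
    have hX' : PowerSeries.constantCoeff (PowerSeries.X : PowerSeries Coef) = 0 := by simp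
    have hv : mapLaurent (evalRegular p) (HahnSeries.single (-1 : ℤ) 1) =
        HahnSeries.single (-1 : ℤ) 1 := by rw [mapLaurent_single, map_one (evalRegular p)]
    have hv' : mapLaurent (evalCoef (p.1.1.2, p.1.2)) var = HahnSeries.single (-1 : ℤ) 1 := by
      rw [var, mapLaurent_single, map_one (evalCoef _)]
    have e1 : Φ.Mspec (embed S p.1.1).1 =
        (Φ.symbols (embed S p.1.1).1).mSeries S var PowerSeries.X :=
      Fields.Mof_eq Φ (support_embed_fst S _) _ _
    have e2 : Φ.expUspec (embed S p.1.1).1 i.2 =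
        (Φ.symbols (embed S p.1.1).1).expSeries i.2 PowerSeries.X := rfl
    simp only [map_mul, map_pow, e1, e2]
    rw [← Symbols.map_mSeries _ _ _ hX, ← Symbols.map_mSeries _ _ _ hX',
      ← Symbols.map_expSeries _ _ _ hX, ← Symbols.map_expSeries _ _ _ hX', hv, hv',
      PowerSeries.map_X, PowerSeries.map_X, hσ, regularSymbols_map]
  change torusIntegral _ = torusIntegral _
  congr 1
  ext a b
  have h1 := hrep.extend_coeff (p := (w, a, b)) hw 1
  rw [hres] at h1
  refine h1.symm.trans ?_
  have e : regularT (hΩ := hΩ) S hΦ i * regularM S hΦ * phaseDer 0 (regularL S hΦ) =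
      laxOf σ.ell ^ i.1 * σ.mSeries S σ.lax σ.laxInv * σ.expSeries i.2 σ.laxInv *
        kDerivation (laxOf σ.ell) := by
    change laxOf σ.ell ^ i.1 * σ.expSeries i.2 σ.laxInv * σ.mSeries S σ.lax σ.laxInv *
      kDerivation (laxOf σ.ell) = _
    ring
  rw [e]

variable (hΩ) in
/-- The right hand sides are holomorphic in the variables `t_{nα}`, `x`, and their cross
derivatives agree. -/
theorem hasFDerivAt_rhs_embed (hΦ : IsSolution Ω Φ) {w : Params S} (hw : w ∈ paramOpens hΩ S) :
    ∃ A : Option (ℕ × ℤ) → Params S →L[ℂ] ℂ,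
      (∀ d, HasFDerivAt (fun w => Φ.rhs d (embed S w)) (A d) w) ∧
      ∀ d e : Option (ℕ × ℤ), (∀ i, d = some i → i ∈ S) → (∀ i, e = some i → i ∈ S) →
        A d (paramDir S e) = A e (paramDir S d) := by
  choose A hA hAv using fun d : Option (ℕ × ℤ) => hasFDerivAt_residueMean hw
    (regularT (hΩ := hΩ) S hΦ (flowIndex d) * regularM S hΦ * phaseDer 0 (regularL S hΦ))
  have hI0 := residueMean_phaseDer_zero (W := paramOpens hΩ S) w
  have hI2 := residueMean_phaseDer_two (W := paramOpens hΩ S) hw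
  have hI3 := residueMean_phaseDer_three (W := paramOpens hΩ S) hw
  have key : ∀ d e : Option (ℕ × ℤ), (∀ i, e = some i → i ∈ S) → A d (paramDir S e) =
      residueMean w (phaseDer 0 (regularB (hΩ := hΩ) S hΦ (flowIndex e)) *
        regularT S hΦ (flowIndex d)) := by
    intro d e he
    obtain ⟨hL, hM, hU⟩ := flowDer_eq (hΩ := hΩ) hΦ he
    rw [hAv]
    refine integral_flow_eq phaseDer_comm hI0 hI2 hI3 (poisson_LM S hΦ) (poisson_LU S hΦ)
      (fun i => phaseDer_E S hΦ i _) _ (flowDer_phaseDer_zero _) hL hM ?_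
    rw [flowDer_E, hU]
  refine ⟨A, fun d => (hA d).congr_of_eventuallyEq ?_, fun d e hd he => ?_⟩
  · filter_upwards [(paramOpens hΩ S).isOpen.mem_nhds hw] with w' hw'
    rw [Fields.rhs_eq_flowIndex]
    exact rhs_embed_eq hΦ _ w' hw'
  · rw [key d e he, key e d hd, ← sub_eq_zero]
    change torusMean w _ - torusMean w _ = 0
    rw [← map_sub]
    have h := integral_deriv_mul_eq_zero phaseDer_comm hI0 hI2 hI3
      (isClosedForm_shiftedDifferential _ _) (isClosedForm_shiftedDifferential _ _)
      (poisson_LM (hΩ := hΩ) S hΦ) (poisson_UV S hΦ) (poisson_LU S hΦ) (poisson_LV S hΦ)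
      (poisson_MU S hΦ) (poisson_MV S hΦ) (fun i => phaseDer_C_algebraMap i _)
      (fun i => phaseDer_E S hΦ i (flowIndex e).2) (fun i => phaseDer_E S hΦ i (flowIndex d).2)
      (flowIndex e).1 (flowIndex d).1
    -- The difference of the two cross derivatives becomes the mean of `res (∂ₖT_e) T_d`, which is
    -- zero by `h`.
    have h' := residue_truncLT_sub (regularT (hΩ := hΩ) S hΦ (flowIndex e))
      (regularT S hΦ (flowIndex d))
    exact (congrArg (torusMean w) h').trans h

end Flows

/-! ### Functions with vanishing partial derivatives -/

/-- No continuity of `G` is assumed. A sup-norm ball is a polydisc, so inside it a point can be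
moved to the centre one coordinate at a time, each move being constant by the one-variable result.
Thus `G` is locally constant, hence constant on a preconnected set. -/
theorem eq_of_hasLineDerivAt_single_eq_zero {ι : Type*} [Fintype ι] [DecidableEq ι]
    {W : Set (ι → ℂ)} (hW : IsOpen W) (hWc : IsPreconnected W) {G : (ι → ℂ) → ℂ}
    (hG : ∀ x ∈ W, ∀ i, HasLineDerivAt ℂ G 0 x (Pi.single i 1)) {x y : ι → ℂ} (hx : x ∈ W)
    (hy : y ∈ W) : G x = G y := by
  have key : ∀ x ∈ W, HasFDerivAt G (0 : (ι → ℂ) →L[ℂ] ℂ) x := by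
    intro x hx
    obtain ⟨r, hr, hball⟩ := Metric.isOpen_iff.1 hW x hx
    refine (hasFDerivAt_const (G x) x).congr_of_eventuallyEq ?_
    filter_upwards [Metric.ball_mem_nhds x hr] with y hy
    have hcoord : ∀ i, y i ∈ Metric.ball (x i) r := fun i =>
      (dist_le_pi_dist y x i).trans_lt hy
    have hstep : ∀ T : Finset ι, G (T.piecewise y x) = G x := by
      intro T
      induction T using Finset.induction_on with
      | empty => rw [Finset.piecewise_empty]
      | insert i T hi ih =>
        rw [← ih, Finset.piecewise_insert]
        set p := T.piecewise y x
        have hp : ∀ j, p j ∈ Metric.ball (x j) r := by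
          intro j
          by_cases hj : j ∈ T
          · simp only [p, Finset.piecewise_eq_of_mem _ _ _ hj, hcoord]
          · simp only [p, Finset.piecewise_eq_of_notMem _ _ _ hj]
            exact Metric.mem_ball_self hr
        have hd : ∀ z ∈ Metric.ball (x i) r,
            HasDerivAt (fun z => G (Function.update p i z)) 0 z := by
          intro z hz
          have hmem : Function.update p i z ∈ W := by
            refine hball ((dist_pi_lt_iff hr).2 fun j => ?_)
            by_cases hj : j = i
            · subst hj
              rw [Function.update_self]
              exact hz
            · rw [Function.update_of_ne hj]
              exact hp j
          have h1 : HasDerivAt _ _ _ := hG _ hmem i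
          have h2 : ∀ s : ℂ, Function.update p i z + s • (Pi.single i 1 : ι → ℂ) =
              Function.update p i (z + s) := by
            intro s
            ext j
            by_cases hj : j = i
            · subst hj
              simp
            · simp [hj]
          simp only [h2] at h1
          have h3 := HasDerivAt.comp_sub_const (x := z) (a := z)
            (f := fun s : ℂ => G (Function.update p i (z + s))) (f' := 0)
            (by rw [sub_self]; exact h1)
          simpa using h3
        have h := Metric.isOpen_ball.is_const_of_deriv_eq_zero (convex_ball (x i) r).isPreconnected
          (fun z hz => (hd z hz).differentiableAt.differentiableWithinAt)
          (fun z hz => (hd z hz).deriv) (hcoord i) (hp i)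
        simpa using h
    have := hstep Finset.univ
    rwa [Finset.piecewise_univ] at this
  exact hW.is_const_of_fderiv_eq_zero hWc
    (fun z hz => (key z hz).differentiableAt.differentiableWithinAt)
    (fun z hz => (key z hz).fderiv) hx hy

/-! ### Coordinates on `(t, x)`-space -/

section Coordinates

variable (S : Finset (ℕ × ℤ))

/-- The inclusion of a coordinate subspace, as a linear map. -/
def embedLinear : Params S →ₗ[ℂ] Times × ℂ where
  toFun := embed S
  map_add' v w := by simp [embed, Finset.sum_add_distrib]
  map_smul' c w := by simp [embed, Finset.smul_sum]

/-- The coordinates of a coordinate subspace. -/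
def paramCoord : Option S → Params S →L[ℂ] ℂ
  | some i => (ContinuousLinearMap.proj i).comp (ContinuousLinearMap.fst ℂ (S → ℂ) ℂ)
  | none => ContinuousLinearMap.snd ℂ (S → ℂ) ℂ

/-- The direction of a coordinate. -/
abbrev coordDir (d : Option S) : Params S := paramDir S (d.map Subtype.val)

theorem mem_of_map_eq_some {d : Option S} {i : ℕ × ℤ} (h : d.map Subtype.val = some i) : i ∈ S := by
  obtain ⟨j, -, rfl⟩ := Option.map_eq_some_iff.1 h
  exact j.2

theorem coordDir_none : coordDir S none = (0, 1) := rfl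

theorem coordDir_some (i : S) : coordDir S (some i) = (Pi.single i 1, 0) := by
  refine Prod.ext (funext fun j => ?_) rfl
  refine Eq.trans ?_ (Pi.single_apply i 1 j).symm
  exact if_congr Subtype.ext_iff.symm rfl rfl

theorem sum_paramCoord_smul (v : Params S) : ∑ d, paramCoord S d v • coordDir S d = v := by
  simp only [Fintype.sum_option, coordDir_none, coordDir_some]
  refine Prod.ext ?_ ?_
  · ext j
    simp [paramCoord, Prod.fst_sum, Finset.sum_apply, Pi.single_apply]
  · simp [paramCoord, Prod.snd_sum]

theorem paramCoord_coordDir (d e : Option S) :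
    paramCoord S d (coordDir S e) = if d = e then 1 else 0 := by
  cases d <;> cases e <;>
    simp [paramCoord, coordDir_none, coordDir_some, Pi.single_apply, -Option.map_some]

variable {S}

theorem exists_embed_eq {q : Times × ℂ} (h : q.1.support ⊆ S) : ∃ w : Params S, embed S w = q := by
  refine ⟨(fun i => q.1 i, q.2), Prod.ext ?_ rfl⟩
  ext i
  rw [embed_fst_apply]
  split_ifs with hi
  · rfl
  · exact (Finsupp.notMem_support_iff.1 fun h' => hi (h h')).symm

theorem hasLineDerivAt_of_hasFDerivAt_embed {f : Times × ℂ → ℂ} {A : Params S →L[ℂ] ℂ}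
    {w : Params S} (h : HasFDerivAt (fun w => f (embed S w)) A w) {d : Option (ℕ × ℤ)}
    (hd : ∀ i, d = some i → i ∈ S) :
    HasLineDerivAt ℂ f (A (paramDir S d)) (embed S w) (direction d) := by
  have h1 : HasDerivAt _ _ _ := h.hasLineDerivAt (paramDir S d)
  simp only [embed_add_smul_paramDir S hd] at h1
  exact h1

end Coordinates

/-! ### Integration of the system -/

section Integration

variable {Ω Ω' : Set (Times × ℂ)} {Φ : Fields} {S : Finset (ℕ × ℤ)}

theorem exists_hasLineDerivAt_rhs (hΩ : IsFinOpen Ω) (hΦ : IsSolution Ω Φ) (d e : Option (ℕ × ℤ))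
    {q : Times × ℂ} (hq : q ∈ Ω) : ∃ c : ℂ, HasLineDerivAt ℂ (Φ.rhs d) c q (direction e) ∧
      HasLineDerivAt ℂ (Φ.rhs e) c q (direction d) := by
  classical
  have hS : ∃ S : Finset (ℕ × ℤ), q.1.support ⊆ S ∧ d.toFinset ⊆ S ∧ e.toFinset ⊆ S :=
    ⟨q.1.support ∪ (d.toFinset ∪ e.toFinset), by grind, by grind, by grind⟩
  obtain ⟨S, h, hd, he⟩ := hS
  obtain ⟨w, rfl⟩ := exists_embed_eq h
  have hd' : ∀ i, d = some i → i ∈ S := fun i hi => hd (by simp [hi])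
  have he' : ∀ i, e = some i → i ∈ S := fun i hi => he (by simp [hi])
  obtain ⟨A, hA, hsymm⟩ := hasFDerivAt_rhs_embed hΩ hΦ hq
  refine ⟨A d (paramDir S e), hasLineDerivAt_of_hasFDerivAt_embed (hA d) he', ?_⟩
  rw [hsymm d e hd' he']
  exact hasLineDerivAt_of_hasFDerivAt_embed (hA e) hd'

variable (Φ S) in
/-- The differential of `F` on a coordinate subspace. -/
def rhsForm (w : Params S) : Params S →L[ℂ] ℂ :=
  ∑ d : Option S, Φ.rhs (d.map Subtype.val) (embed S w) • paramCoord S d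

theorem rhsForm_coordDir (w : Params S) (d : Option S) :
    rhsForm Φ S w (coordDir S d) = Φ.rhs (d.map Subtype.val) (embed S w) := by
  rw [rhsForm, sum_apply, Finset.sum_eq_single d]
  · rw [smul_apply, paramCoord_coordDir, if_pos rfl, smul_eq_mul, mul_one]
  · intro e _ he
    rw [smul_apply, paramCoord_coordDir, if_neg he, smul_zero]
  · exact fun h => (h (Finset.mem_univ d)).elim

/-- Symmetry of the derivative is closedness of the 1-form; in coordinates it is the equality of the
cross derivatives. -/
theorem hasFDerivAt_rhsForm (hΩ : IsFinOpen Ω) (hΦ : IsSolution Ω Φ) {w : Params S}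
    (hw : embed S w ∈ Ω) : ∃ D : Params S →L[ℂ] Params S →L[ℂ] ℂ,
      HasFDerivAt (rhsForm Φ S) D w ∧ ∀ v v', D v v' = D v' v := by
  obtain ⟨A, hA, hsymm⟩ := hasFDerivAt_rhs_embed (S := S) hΩ hΦ hw
  refine ⟨∑ d : Option S, (A (d.map Subtype.val)).smulRight (paramCoord S d),
    HasFDerivAt.fun_sum fun d _ => (hA _).smul_const (paramCoord S d), fun v v' => ?_⟩
  have h : ∀ v v', (∑ d : Option S, (A (d.map Subtype.val)).smulRight (paramCoord S d)) v v' =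
      ∑ d : Option S, ∑ e : Option S, paramCoord S e v * paramCoord S d v' *
        A (d.map Subtype.val) (coordDir S e) := by
    intro v v'
    rw [sum_apply, sum_apply]
    refine Finset.sum_congr rfl fun d _ => ?_
    conv_lhs => rw [ContinuousLinearMap.smulRight_apply, smul_apply,
      ← sum_paramCoord_smul S v, map_sum, Finset.sum_smul]
    refine Finset.sum_congr rfl fun e _ => ?_
    rw [map_smul, smul_eq_mul, smul_eq_mul]
    ring
  rw [h, h, Finset.sum_comm]
  refine Finset.sum_congr rfl fun e _ => Finset.sum_congr rfl fun d _ => ?_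
  rw [hsymm _ _ (fun i => mem_of_map_eq_some S) (fun i => mem_of_map_eq_some S)]
  ring

variable (Φ) in
/-- The differential of `F`, evaluated on a vector. -/
def rhsPairing (q v : Times × ℂ) : ℂ :=
  (v.1.sum fun i c => c * Φ.rhs (some i) q) + v.2 * Φ.rhs none q

theorem rhsPairing_embed (w v : Params S) :
    rhsPairing Φ (embed S w) (embed S v) = rhsForm Φ S w v := by
  rw [rhsPairing, Finsupp.sum_of_support_subset _ (support_embed_fst S v) _ (by simp), rhsForm,
    sum_apply, Fintype.sum_option, add_comm, ← Finset.sum_coe_sort]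
  congr 1
  · simp [paramCoord, embed, mul_comm]
  · refine Finset.sum_congr rfl fun i _ => ?_
    rw [embed_fst_apply, dif_pos i.2]
    simp [paramCoord, mul_comm]

variable (Φ) in
/-- The integral of the system along the segment from `q₀` to `q`. -/
def segmentIntegral (q₀ q : Times × ℂ) : ℂ :=
  ∫ s in (0 : ℝ)..1, rhsPairing Φ (AffineMap.lineMap q₀ q s) (q - q₀)

/-- The left side does not depend on `S`, whereas the right side is accessible to the
finite-dimensional Poincaré lemma. One global primitive thereby restricts correctly to every
coordinate subspace. -/
theorem segmentIntegral_embed (w₀ w : Params S) : segmentIntegral Φ (embed S w₀) (embed S w) =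
    curveIntegral (rhsForm Φ S) (.segment w₀ w) := by
  rw [curveIntegral_segment, segmentIntegral]
  refine intervalIntegral.integral_congr fun s _ => ?_
  have h1 : embed S w - embed S w₀ = embed S (w - w₀) := (map_sub (embedLinear S) w w₀).symm
  have h2 : AffineMap.lineMap (embed S w₀) (embed S w) s = embed S (AffineMap.lineMap w₀ w s) :=
    (AffineMap.apply_lineMap ((embedLinear S).restrictScalars ℝ).toAffineMap w₀ w s).symm
  simp only [h1, h2, rhsPairing_embed]

theorem hasFDerivAt_segmentIntegral_embed (hΩ : IsFinOpen Ω) (hΦ : IsSolution Ω Φ) (hsub : Ω' ⊆ Ω)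
    (hΩ' : IsFinOpen Ω') (hconv : Convex ℝ Ω') {w₀ w : Params S} (hw₀ : embed S w₀ ∈ Ω')
    (hw : embed S w ∈ Ω') :
    HasFDerivAt (fun w => segmentIntegral Φ (embed S w₀) (embed S w)) (rhsForm Φ S w) w := by
  simp only [segmentIntegral_embed]
  have hW : Convex ℝ (embed S ⁻¹' Ω') :=
    hconv.linear_preimage ((embedLinear S).restrictScalars ℝ)
  -- The implication inside the existential allows a derivative to be chosen at all points, with the
  -- value `0` outside the domain.
  have hD : ∀ v : Params S, ∃ D : Params S →L[ℂ] Params S →L[ℂ] ℂ, embed S v ∈ Ω' →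
      HasFDerivAt (rhsForm Φ S) D v ∧ ∀ u u', D u u' = D u' u := by
    intro v
    by_cases hv : embed S v ∈ Ω'
    · obtain ⟨D, hD⟩ := hasFDerivAt_rhsForm hΩ hΦ (hsub hv)
      exact ⟨D, fun _ => hD⟩
    · exact ⟨0, fun h => (hv h).elim⟩
  choose D hD using hD
  exact (hW.hasFDerivWithinAt_curveIntegral_segment_of_hasFDerivWithinAt_symmetric
    (fun v hv => ((hD v hv).1.restrictScalars ℝ).hasFDerivWithinAt)
    (fun v hv u _ u' _ => (hD v hv).2 u u') hw₀ hw).hasFDerivAt ((hΩ' S).mem_nhds hw)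

theorem solvesFSystem_segmentIntegral (hΩ : IsFinOpen Ω) (hΦ : IsSolution Ω Φ) (hsub : Ω' ⊆ Ω)
    (hΩ' : IsFinOpen Ω') (hconv : Convex ℝ Ω') {q₀ : Times × ℂ} (hq₀ : q₀ ∈ Ω') :
    SolvesFSystem Ω' Φ fun q _ => segmentIntegral Φ q₀ q := by
  classical
  refine fun q hq θ => ⟨fun d => ?_, hasDerivAt_const _ _, hasDerivAt_const _ _⟩
  -- One finite set of times accommodates both endpoints and the direction of differentiation.
  have hS : ∃ S : Finset (ℕ × ℤ), q₀.1.support ⊆ S ∧ q.1.support ⊆ S ∧ d.toFinset ⊆ S :=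
    ⟨q₀.1.support ∪ (q.1.support ∪ d.toFinset), by grind, by grind, by grind⟩
  obtain ⟨S, h₀, h, hd⟩ := hS
  obtain ⟨w₀, rfl⟩ := exists_embed_eq h₀
  obtain ⟨w, rfl⟩ := exists_embed_eq h
  have hd' : ∀ i, d = some i → i ∈ S := fun i hi => hd (by simp [hi])
  obtain ⟨d', rfl⟩ : ∃ d' : Option S, d'.map Subtype.val = d := by
    cases d with
    | none => exact ⟨none, rfl⟩
    | some i => exact ⟨some ⟨i, hd' i rfl⟩, rfl⟩
  rw [← rhsForm_coordDir]
  exact hasLineDerivAt_of_hasFDerivAt_embed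
    (hasFDerivAt_segmentIntegral_embed hΩ hΦ hsub hΩ' hconv hq₀ hq) hd'

theorem SolvesFSystem.eq_at_zero {F : Times × ℂ → ℝ × ℝ → ℂ} (hF : SolvesFSystem Ω' Φ F)
    {q : Times × ℂ} (hq : q ∈ Ω') (θ : ℝ × ℝ) : F q θ = F q 0 := by
  have h1 : F q (θ.1, θ.2) = F q (0, θ.2) := is_const_of_deriv_eq_zero
    (f := fun s => F q (s, θ.2)) (fun s => (hF q hq (s, θ.2)).2.1.differentiableAt)
    (fun s => (hF q hq (s, θ.2)).2.1.deriv) _ _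
  have h2 : F q (0, θ.2) = F q (0, 0) := is_const_of_deriv_eq_zero
    (f := fun s => F q (0, s)) (fun s => (hF q hq (0, s)).2.2.differentiableAt)
    (fun s => (hF q hq (0, s)).2.2.deriv) _ _
  exact h1.trans h2

theorem SolvesFSystem.sub_eq_sub (hΩ' : IsFinOpen Ω') (hconv : Convex ℝ Ω')
    {F F' : Times × ℂ → ℝ × ℝ → ℂ} (hF : SolvesFSystem Ω' Φ F) (hF' : SolvesFSystem Ω' Φ F')
    {q q₀ : Times × ℂ} (hq : q ∈ Ω') (hq₀ : q₀ ∈ Ω') (θ : ℝ × ℝ) :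
    F q θ - F' q θ = F q₀ θ - F' q₀ θ := by
  classical
  have hS : ∃ S : Finset (ℕ × ℤ), q₀.1.support ⊆ S ∧ q.1.support ⊆ S :=
    ⟨q₀.1.support ∪ q.1.support, by grind, by grind⟩
  obtain ⟨S, h₀, h⟩ := hS
  obtain ⟨w₀, rfl⟩ := exists_embed_eq h₀
  obtain ⟨w, rfl⟩ := exists_embed_eq h
  -- All coordinates, `x` included, are put on the same footing, as required by
  -- `eq_of_hasLineDerivAt_single_eq_zero`.
  set P : (Option S → ℂ) →ₗ[ℂ] Params S :=
    ((LinearMap.funLeft ℂ ℂ some).prod (LinearMap.proj none)) with hP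
  have hPc : Continuous P := P.continuous_of_finiteDimensional
  have hPdir : ∀ d, P (Pi.single d 1) = coordDir S d := by
    intro d
    cases d with
    | none =>
      rw [coordDir_none]
      refine Prod.ext (funext fun j => ?_) ?_ <;> simp [hP, LinearMap.funLeft]
    | some i =>
      rw [coordDir_some]
      refine Prod.ext (funext fun j => ?_) ?_ <;> simp [hP, LinearMap.funLeft, Pi.single_apply]
  have hW : IsOpen (P ⁻¹' (embed S ⁻¹' Ω')) := (hΩ' S).preimage hPc
  have hWc : Convex ℝ (P ⁻¹' (embed S ⁻¹' Ω')) :=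
    hconv.linear_preimage (((embedLinear S).comp P).restrictScalars ℝ)
  have hG := eq_of_hasLineDerivAt_single_eq_zero hW hWc.isPreconnected
    (G := fun a => F (embed S (P a)) θ - F' (embed S (P a)) θ) (fun a ha d => ?_)
    (x := fun d => paramCoord S d w) (y := fun d => paramCoord S d w₀) hq hq₀
  · exact hG
  · have h1 : HasDerivAt _ _ _ := (hF _ ha θ).1 (d.map Subtype.val)
    have h2 : HasDerivAt _ _ _ := (hF' _ ha θ).1 (d.map Subtype.val)
    have h3 := h1.sub h2
    rw [sub_self] at h3
    refine HasDerivAt.congr_of_eventuallyEq h3 (Filter.Eventually.of_forall fun s => ?_)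
    simp only [map_add, map_smul, hPdir, Pi.sub_apply]
    rw [embed_add_smul_paramDir S fun i => mem_of_map_eq_some S]

end Integration

end Toroidal

end

theorem mainTheorem2 (Ω : Set (Toroidal.Times × ℂ)) (hΩ : Toroidal.IsFinOpen Ω)
    (Φ : Toroidal.Fields) (hΦ : Toroidal.IsSolution Ω Φ) :
    (∀ d e : Option (ℕ × ℤ), ∀ q ∈ Ω, ∃ c : ℂ,
      HasLineDerivAt ℂ (Φ.rhs d) c q (Toroidal.direction e) ∧
      HasLineDerivAt ℂ (Φ.rhs e) c q (Toroidal.direction d)) ∧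
    (∀ Ω' : Set (Toroidal.Times × ℂ), Ω' ⊆ Ω → Toroidal.IsFinOpen Ω' → Convex ℝ Ω' →
      ∃ F₀ : Toroidal.Times × ℂ → ℂ,
        Toroidal.SolvesFSystem Ω' Φ (fun q _ => F₀ q) ∧
        ∀ F : Toroidal.Times × ℂ → ℝ × ℝ → ℂ, Toroidal.SolvesFSystem Ω' Φ F →
          ∃ c : ℂ, ∀ q ∈ Ω', ∀ θ : ℝ × ℝ, F q θ = F₀ q + c) := by
  refine ⟨fun d e q hq => Toroidal.exists_hasLineDerivAt_rhs hΩ hΦ d e hq,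
    fun Ω' hsub hΩ' hconv => ?_⟩
  rcases Ω'.eq_empty_or_nonempty with rfl | ⟨q₀, hq₀⟩
  · exact ⟨0, fun q hq => hq.elim, fun F _ => ⟨0, fun q hq => hq.elim⟩⟩
  have hF₀ := Toroidal.solvesFSystem_segmentIntegral hΩ hΦ hsub hΩ' hconv hq₀
  -- The constant is the difference of the two solutions at the base point, with `θ` first moved to
  -- `0`.
  refine ⟨_, hF₀, fun F hF => ⟨F q₀ 0 - Toroidal.segmentIntegral Φ q₀ q₀, fun q hq θ => ?_⟩⟩
  rw [hF.eq_at_zero hq θ, ← hF.sub_eq_sub hΩ' hconv hF₀ hq hq₀ 0]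
  ring
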